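/- Let $\pi:E\to B$ be a holomorphic vector bundle of finite rank over a (Hausdorff, finite-dimensional) complex manifold $B$, with zero section $Z\subseteq E$, and let $G$ be a group acting on $E$ by bundle automorphisms: $G$ acts on $E$ and on $B$, each $g\in G$ acts on the total space $E$ by a holomorphic map, and $g$ maps each fibre $E_b$ linearly to the fibre $E_{g\cdot b}$. Let $U\subseteq E$ be a $G$-invariant open neighbourhood of $Z$, and let $\omega_0$ and $\omega_1$ be two $G$-invariant complex-symplectic forms on $U$, i.e. closed non-degenerate holomorphic 2-forms with $g^*\omega_i=\omega_i$ for all $g\in G$. Suppose that $\omega_0|_Z=\omega_1|_Z$, in the sense that $(\omega_0)_p=(\omega_1)_p$ as bilinear forms on the full tangent space $T_pE$ for every $p\in Z$. Then there are $G$-invariant open neighbourhoods $U_0$ and $U_1$ of $Z$ contained in $U$ and a $G$-equivariant biholomorphism $f:U_0\to U_1$ such that $f^*\omega_1=\omega_0$ and $f(p)=p$ for all $p\in Z$. -/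

import Mathlib

open Set
open scoped ContDiff Manifold

noncomputable section

namespace HoloDW

section Forms

variable {V : Type*} [NormedAddCommGroup V] [NormedSpace ℂ V]
  {H : Type*} [TopologicalSpace H] (I : ModelWithCorners ℂ V H)
  (M : Type*) [TopologicalSpace M] [ChartedSpace H M]

/-- A (not necessarily continuous) field of alternating complex-bilinear forms on the tangent
spaces of `M`. Forms on an open subset `U` are represented by such fields; their values outside
`U` are irrelevant. -/
abbrev TwoForm : Type _ := ∀ p : M, (TangentSpace I p) [⋀^Fin 2]→L[ℂ] ℂ

variable {I M}

/-- The coordinate expression `(φ⁻¹)^* σ` of a 2-form `σ` in the preferred chart `φ` at `x`. -/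
def TwoForm.inChart (σ : TwoForm I M) (x : M) : V → V [⋀^Fin 2]→L[ℂ] ℂ := fun y =>
  (σ ((extChartAt I x).symm y)).compContinuousLinearMap
    (mfderiv 𝓘(ℂ, V) I (extChartAt I x).symm y)

/-- The part of the range of the preferred chart at `x` that corresponds to `U`. -/
def chartDomain (I : ModelWithCorners ℂ V H) (U : Set M) (x : M) : Set V :=
  (extChartAt I x).target ∩ (extChartAt I x).symm ⁻¹' U

/-- `σ` is a complex-symplectic form on the open subset `U` of the (boundaryless) complex manifold
`M`: a closed and non-degenerate holomorphic 2-form. Here `ContDiffOn ℂ ω` means complex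
analytic, and `extDeriv` is the exterior derivative on the model vector space. -/
structure IsComplexSymplecticOn (σ : TwoForm I M) (U : Set M) : Prop where
  holomorphic : ∀ x : M, ContDiffOn ℂ ω (σ.inChart x) (chartDomain I U x)
  closed : ∀ x : M, ∀ y ∈ chartDomain I U x, extDeriv (σ.inChart x) y = 0
  nondegenerate : ∀ p ∈ U, ∀ v : TangentSpace I p,
    (∀ w : TangentSpace I p, σ p ![v, w] = 0) → v = 0

/-- The pullback `(f^* σ)_p = σ_{f p} (df_p ·, df_p ·)`. -/
def TwoForm.pullback (f : M → M) (σ : TwoForm I M) : TwoForm I M := fun p =>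
  (σ (f p)).compContinuousLinearMap (mfderiv I I f p)

end Forms

/-- The subset `U` is invariant under the action of `G`. -/
def IsInvariant (G : Type*) {X : Type*} [SMul G X] (U : Set X) : Prop :=
  ∀ g : G, ∀ p ∈ U, g • p ∈ U

/-- The 2-form `σ` on the `G`-invariant set `U` is `G`-invariant: `g^* σ = σ` on `U`. -/
def TwoForm.IsInvariantOn (G : Type*) {V : Type*} [NormedAddCommGroup V] [NormedSpace ℂ V]
    {H : Type*} [TopologicalSpace H] {I : ModelWithCorners ℂ V H}
    {M : Type*} [TopologicalSpace M] [ChartedSpace H M] [SMul G M]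
    (σ : TwoForm I M) (U : Set M) : Prop :=
  ∀ g : G, ∀ p ∈ U, σ.pullback (fun q : M => g • q) p = σ p

/-- The group `G` acts on the holomorphic vector bundle `E → B` by bundle automorphisms (covering
an action on the base): each `g` is a holomorphic self-map of the total space, and it maps the
fibre over `b` linearly to the fibre over `g • b`. The inverse of `g` is the action of `g⁻¹`, so
it has the same properties, and the map that `g` induces on the base is automatically
biholomorphic. -/
structure ActsByBundleAutomorphisms (G : Type*) [Group G]
    {EB : Type*} [NormedAddCommGroup EB] [NormedSpace ℂ EB]
    {B : Type*} [TopologicalSpace B] [ChartedSpace EB B]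
    (F : Type*) [NormedAddCommGroup F] [NormedSpace ℂ F]
    (E : B → Type*) [TopologicalSpace (Bundle.TotalSpace F E)]
    [∀ b, AddCommGroup (E b)] [∀ b, Module ℂ (E b)] [∀ b, TopologicalSpace (E b)]
    [FiberBundle F E]
    [MulAction G B] [MulAction G (Bundle.TotalSpace F E)] : Prop where
  holomorphic : ∀ g : G, ContMDiff (𝓘(ℂ, EB).prod 𝓘(ℂ, F)) (𝓘(ℂ, EB).prod 𝓘(ℂ, F)) ω
    (fun e : Bundle.TotalSpace F E => g • e)
  linear : ∀ (g : G) (b : B), ∃ L : E b →ₗ[ℂ] E (g • b), ∀ v : E b,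
    g • (⟨b, v⟩ : Bundle.TotalSpace F E) = ⟨g • b, L v⟩

/-- The zero section of `E`, as a subset of the total space. -/
def zeroSet {B : Type*} (F : Type*) (E : B → Type*) [∀ b, Zero (E b)] :
    Set (Bundle.TotalSpace F E) :=
  range (Bundle.zeroSection F E)

end HoloDW

end

/-! This is Moser's trick, arranged so that nothing has to be averaged over `G`. Put $A=\omega_0$
and $S=\omega_1-\omega_0$, a closed form vanishing at the points of $Z$. Integrating $S$ along the
fibrewise scalings $m_t$ gives an explicit 1-form $\beta$ (`radialPotential`) with $d\beta=S$, whose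
1-jet vanishes along $Z$ (`exists_analyticAt_radialPotential`). Near $Z$ the form $A+tS$ is
non-degenerate for all $t\in[-1,2]$, and Moser's equation $(A+tS)(X_t,\cdot)=-\beta$ defines a
time-dependent field that vanishes on $Z$. By Cartan's formula the pullback of $A+tS$ along its flow
is constant in $t$ (`moser_pullback`), so the time-one map pulls $\omega_1$ back to $\omega_0$ and
fixes $Z$.

The local flow with analytic dependence on the initial point comes from the analytic inverse
function theorem in a Banach space of velocity curves (`exists_moserVelocity`). Superposition
operators of analytic maps are analytic near constant curves, and the linearisation of Moser's
equation at the constant curve $p_0\in Z$ is the invertible map $A(p_0)$.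

Globally, $\beta$ is natural under maps that commute with the scalings and preserve $S$. The charts
are indexed by $B\times G$: a bundle chart preceded by the action of a group element. Changes of
charts and group elements thus enter on the same footing, as transition maps that preserve $A$, $S$
and the scalings (`isMoserAtlas_chart`), hence also $X_t$. Uniqueness of integral curves in the
Hausdorff space $E$ (`IsMoserAtlas.eq_of_isIntegralCurveIn`) then makes the local time-one maps
agree on overlaps and makes the glued map injective (`IsMoserAtlas.exists_timeOneMap`). Equivariance
follows by using the same local flow in the charts $(b,k)$ for all $k\in G$. -/

noncomputable section

namespace HoloDW

open Filter Topology MeasureTheory intervalIntegral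

/-! ### Analysis in spaces of continuous curves -/

section Curves

variable {K : Type*} [TopologicalSpace K] [CompactSpace K]
  {V : Type*} [NormedAddCommGroup V] [NormedSpace ℂ V]
  {W : Type*} [NormedAddCommGroup W] [NormedSpace ℂ W]
  {X : Type*} [NormedAddCommGroup X] [NormedSpace ℂ X]

/-- A continuous multilinear map acts pointwise on continuous functions. -/
def pointwiseMultilinear (K : Type*) [TopologicalSpace K] [CompactSpace K] {n : ℕ}
    (a : V [×n]→L[ℂ] W) : C(K, V) [×n]→L[ℂ] C(K, W) :=
  MultilinearMap.mkContinuous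
    { toFun := fun γ => ⟨fun s => a fun i => γ i s, by fun_prop⟩
      map_update_add' := by
        intro _ γ i x y
        ext s
        have h : ∀ z : C(K, V), (fun j => Function.update γ i z j s) =
            Function.update (fun j => γ j s) i (z s) := by
          intro z; ext j; by_cases hj : j = i
          · subst hj; simp
          · simp [hj]
        simp [h]
      map_update_smul' := by
        intro _ γ i c x
        ext s
        have h : ∀ z : C(K, V), (fun j => Function.update γ i z j s) =
            Function.update (fun j => γ j s) i (z s) := by
          intro z; ext j; by_cases hj : j = i
          · subst hj; simp
          · simp [hj]
        simp [h] }
    ‖a‖ (by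
      intro γ
      refine (ContinuousMap.norm_le _ (by positivity)).2 fun s => ?_
      refine (a.le_opNorm _).trans ?_
      gcongr with i
      exact (γ i).norm_coe_le_norm s)

@[simp] lemma pointwiseMultilinear_apply {n : ℕ} (a : V [×n]→L[ℂ] W) (γ : Fin n → C(K, V)) (s : K) :
    pointwiseMultilinear K a γ s = a fun i => γ i s := rfl

lemma norm_pointwiseMultilinear_le {n : ℕ} (a : V [×n]→L[ℂ] W) :
    ‖pointwiseMultilinear K a‖ ≤ ‖a‖ :=
  MultilinearMap.mkContinuous_norm_le _ (norm_nonneg _) _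

/-- The superposition operator of an analytic map is analytic near constant curves. -/
theorem exists_analyticAt_superposition [CompleteSpace W] {f : V → W} {p : V}
    (hf : AnalyticAt ℂ f p) :
    ∃ N : C(K, V) → C(K, W), AnalyticAt ℂ N (ContinuousMap.const K p) ∧
      ∀ᶠ γ in 𝓝 (ContinuousMap.const K p), ∀ s, N γ s = f (γ s) := by
  obtain ⟨a, r, ha⟩ := hf
  -- Letting the Taylor coefficients of `f` at `p` act pointwise does not increase their norms, so
  -- the new series converges at least as far; evaluation at `s` turns it back into the series of
  -- `f`. A single expansion point serves all `s`, whence the restriction to curves near a constant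
  -- one.
  let b : FormalMultilinearSeries ℂ C(K, V) C(K, W) := fun n => pointwiseMultilinear K (a n)
  have hrad : a.radius ≤ b.radius := by
    refine ENNReal.le_of_forall_nnreal_lt fun ρ hρ => ?_
    refine b.le_radius_of_summable_nnnorm ?_
    refine NNReal.summable_of_le (fun n => ?_) (a.summable_nnnorm_mul_pow hρ)
    gcongr
    exact norm_pointwiseMultilinear_le (a n)
  have hb := b.hasFPowerSeriesOnBall (ha.r_pos.trans_le (ha.r_le.trans hrad))
  have hb' := hb.comp_sub (ContinuousMap.const K p)
  rw [zero_add] at hb'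
  refine ⟨_, hb'.analyticAt, ?_⟩
  filter_upwards [Metric.eball_mem_nhds (ContinuousMap.const K p) ha.r_pos] with γ hγ s
  have h0 : γ - ContinuousMap.const K p ∈ Metric.eball (0 : C(K, V)) r := by
    simpa [edist_eq_enorm_sub] using hγ
  have h1 := hb.hasSum (Metric.eball_subset_eball (ha.r_le.trans hrad) h0)
  have h2 := h1.mapL (ContinuousMap.evalCLM ℂ s)
  have h3 : γ s - p ∈ Metric.eball (0 : V) r := by
    simp only [Metric.mem_eball, edist_zero_right] at h0 ⊢
    refine lt_of_le_of_lt ?_ h0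
    have := (γ - ContinuousMap.const K p).norm_coe_le_norm s
    simpa [enorm_le_iff_norm_le] using this
  have h4 := ha.hasSum h3
  rw [add_sub_cancel] at h4
  refine HasSum.unique ?_ h4
  simpa [b] using h2

/-- A continuous bilinear map acts pointwise on continuous functions. -/
def pointwiseBilinear (K : Type*) [TopologicalSpace K] [CompactSpace K] (B : V →L[ℂ] W →L[ℂ] X) :
    C(K, V) →L[ℂ] C(K, W) →L[ℂ] C(K, X) :=
  LinearMap.mkContinuous₂
    (LinearMap.mk₂ ℂ (fun γ δ => (⟨fun s => B (γ s) (δ s), by fun_prop⟩ : C(K, X)))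
      (by intros; ext; simp) (by intros; ext; simp) (by intros; ext; simp) (by intros; ext; simp))
    ‖B‖ (by
      intro γ δ
      refine (ContinuousMap.norm_le _ (by positivity)).2 fun s => ?_
      refine (B.le_opNorm₂ _ _).trans ?_
      gcongr
      · exact γ.norm_coe_le_norm s
      · exact δ.norm_coe_le_norm s)

variable {Y : Type*} [NormedAddCommGroup Y] [NormedSpace ℂ Y]

lemma contDiffAt_pointwiseBilinear (B : V →L[ℂ] W →L[ℂ] X) {n : WithTop ℕ∞} {f : Y → C(K, V)}
    {g : Y → C(K, W)} {y : Y} (hf : ContDiffAt ℂ n f y) (hg : ContDiffAt ℂ n g y) :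
    ContDiffAt ℂ n (fun x => pointwiseBilinear K B (f x) (g x)) y :=
  ((pointwiseBilinear K B).contDiff.contDiffAt.comp (g := pointwiseBilinear K B) y hf).clm_apply hg

lemma exists_contDiffAt_superposition [CompleteSpace W] {f : V → W} {p : V}
    (hf : AnalyticAt ℂ f p) {g : Y → C(K, V)} {y : Y} (hg : ContDiffAt ℂ ω g y)
    (hy : g y = ContinuousMap.const K p) :
    ∃ h : Y → C(K, W), ContDiffAt ℂ ω h y ∧ ∀ᶠ x in 𝓝 y, ∀ s, h x s = f (g x s) := by
  obtain ⟨N, hN, hNf⟩ := exists_analyticAt_superposition (K := K) hf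
  rw [← hy] at hN hNf
  exact ⟨fun x => N (g x), hN.contDiffAt.comp (g := N) y hg, hg.continuousAt.eventually hNf⟩

lemma hasFDerivAt_eval {Q : Y → C(K, W)} {y : Y} (hQ : DifferentiableAt ℂ Q y) (s : K) :
    HasFDerivAt (fun x => Q x s) ((ContinuousMap.evalCLM ℂ s).comp (fderiv ℂ Q y)) y :=
  (ContinuousMap.evalCLM ℂ s : C(K, W) →L[ℂ] W).hasFDerivAt.comp
    (g := (ContinuousMap.evalCLM ℂ s : C(K, W) →L[ℂ] W)) y hQ.hasFDerivAt

lemma eventually_differentiableAt {Q : Y → W} {y : Y} (hQ : ContDiffAt ℂ ω Q y) :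
    ∀ᶠ x in 𝓝 y, DifferentiableAt ℂ Q x := by
  filter_upwards [(hQ.of_le (m := 1) le_top).eventually (by simp)] with p hp
  exact hp.differentiableAt (by simp)

end Curves

/-! ### The time interval, with `[0, 1]` in its interior, and integration of curves -/

/-- The time interval on which flows are constructed. -/
abbrev TimeInterval : Type := Icc (-1 : ℝ) 2

lemma neg_one_le_two : (-1 : ℝ) ≤ 2 := by norm_num

/-- The extension of a curve on the time interval to a curve that is constant outside of it. -/
abbrev extendCurve {V : Type*} [TopologicalSpace V] (ξ : C(TimeInterval, V)) : ℝ → V :=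
  IccExtend neg_one_le_two ξ

lemma continuous_extendCurve {V : Type*} [TopologicalSpace V] (ξ : C(TimeInterval, V)) :
    Continuous (extendCurve ξ) := ξ.continuous.Icc_extend'

lemma extendCurve_apply {V : Type*} [TopologicalSpace V] (ξ : C(TimeInterval, V))
    {t : ℝ} (ht : t ∈ Icc (-1 : ℝ) 2) : extendCurve ξ t = ξ ⟨t, ht⟩ :=
  IccExtend_of_mem _ _ ht

section Primitive

variable {V : Type*} [NormedAddCommGroup V] [NormedSpace ℂ V]

/-- The primitive of a curve that vanishes at time `0`, as a continuous linear operator. -/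
def primitive (V : Type*) [NormedAddCommGroup V] [NormedSpace ℂ V] :
    C(TimeInterval, V) →L[ℂ] C(TimeInterval, V) :=
  LinearMap.mkContinuous
    { toFun := fun ξ => ⟨fun t => ∫ s in (0 : ℝ)..t, extendCurve ξ s,
        (continuous_primitive
          (fun a b => (continuous_extendCurve ξ).intervalIntegrable a b) 0).comp
          continuous_subtype_val⟩
      map_add' := by
        intro ξ η
        ext t
        exact integral_add ((continuous_extendCurve ξ).intervalIntegrable _ _)
          ((continuous_extendCurve η).intervalIntegrable _ _)
      map_smul' := by
        intro c ξ
        ext t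
        exact integral_smul c (extendCurve ξ) }
    2 (by
      intro ξ
      refine (ContinuousMap.norm_le _ (by positivity)).2 fun t => ?_
      refine (norm_integral_le_of_norm_le_const (C := ‖ξ‖)
        fun s _ => ξ.norm_coe_le_norm _).trans ?_
      rw [mul_comm]
      gcongr
      rw [sub_zero, abs_le]
      exact ⟨by linarith [t.2.1], t.2.2⟩)

lemma primitive_apply (ξ : C(TimeInterval, V)) (t : TimeInterval) :
    primitive V ξ t = ∫ s in (0 : ℝ)..t, extendCurve ξ s := rfl

lemma extendCurve_primitive (ξ : C(TimeInterval, V)) {t : ℝ} (ht : t ∈ Icc (-1 : ℝ) 2) :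
    extendCurve (primitive V ξ) t = ∫ s in (0 : ℝ)..t, extendCurve ξ s := by
  rw [extendCurve_apply _ ht, primitive_apply]

lemma hasDerivAt_extendCurve_primitive [CompleteSpace V] (ξ : C(TimeInterval, V)) {t : ℝ}
    (ht : t ∈ Ioo (-1 : ℝ) 2) :
    HasDerivAt (extendCurve (primitive V ξ)) (extendCurve ξ t) t := by
  have h : HasDerivAt (fun t => ∫ s in (0 : ℝ)..t, extendCurve ξ s) (extendCurve ξ t) t :=
    (continuous_extendCurve ξ).integral_hasStrictDerivAt 0 t |>.hasDerivAt
  refine h.congr_of_eventuallyEq ?_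
  filter_upwards [Ioo_mem_nhds ht.1 ht.2] with s hs
  exact extendCurve_primitive ξ (Ioo_subset_Icc_self hs)

/-- Integration of curves over the unit interval. -/
def unitIntegral (V : Type*) [NormedAddCommGroup V] [NormedSpace ℂ V] :
    C(TimeInterval, V) →L[ℂ] V :=
  (ContinuousMap.evalCLM ℂ ⟨1, by norm_num⟩).comp (primitive V)

lemma unitIntegral_apply (ξ : C(TimeInterval, V)) :
    unitIntegral V ξ = ∫ t in (0 : ℝ)..1, extendCurve ξ t := rfl

lemma unitIntegral_apply_apply {W : Type*} [NormedAddCommGroup W] [NormedSpace ℂ W]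
    [CompleteSpace W] (ξ : C(TimeInterval, V →L[ℂ] W)) (v : V) :
    unitIntegral (V →L[ℂ] W) ξ v = ∫ t in (0 : ℝ)..1, extendCurve ξ t v := by
  rw [unitIntegral_apply, ContinuousLinearMap.intervalIntegral_apply
    ((continuous_extendCurve ξ).intervalIntegrable _ _)]

end Primitive

end HoloDW

namespace HoloDW

open Filter Topology MeasureTheory intervalIntegral

/-! ### The relative Poincaré lemma -/

section Poincare

variable {V : Type*} [NormedAddCommGroup V] [NormedSpace ℂ V]

/-- The Euler vector field with linear zero locus the range of the projection `P`. -/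
def eulerField (P : V →L[ℂ] V) : V →L[ℂ] V := ContinuousLinearMap.id ℂ V - P

/-- The scaling by `z` along the kernel of the projection `P`. -/
def fibreScale (P : V →L[ℂ] V) (z : ℂ) : V →L[ℂ] V := P + z • eulerField P

lemma eulerField_apply (P : V →L[ℂ] V) (p : V) : eulerField P p = p - P p := rfl

lemma fibreScale_apply (P : V →L[ℂ] V) (z : ℂ) (p : V) :
    fibreScale P z p = P p + z • eulerField P p := rfl

lemma fibreScale_one (P : V →L[ℂ] V) (p : V) : fibreScale P 1 p = p := by
  simp [fibreScale_apply, eulerField_apply]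

lemma fibreScale_zero (P : V →L[ℂ] V) (p : V) : fibreScale P 0 p = P p := by
  simp [fibreScale_apply]

lemma eulerField_eq_zero {P : V →L[ℂ] V} {p : V} (hp : P p = p) : eulerField P p = 0 := by
  rw [eulerField_apply, hp, sub_self]

lemma fibreScale_eq_self {P : V →L[ℂ] V} {p : V} (hp : P p = p) (z : ℂ) :
    fibreScale P z p = p := by
  rw [fibreScale_apply, eulerField_eq_zero hp, hp, smul_zero, add_zero]

lemma continuous_fibreScale (P : V →L[ℂ] V) : Continuous (fibreScale P) := by
  unfold fibreScale
  fun_prop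

lemma hasDerivAt_fibreScale (P : V →L[ℂ] V) (p : V) (z : ℂ) :
    HasDerivAt (fun z => fibreScale P z p) (eulerField P p) z := by
  have h := ((hasDerivAt_id z).smul_const (eulerField P p)).const_add (P p)
  rw [one_smul] at h
  exact h

/-- The displacement of the scaled point from `p₀` is a convex combination of `p - p₀` and `P (p -
p₀)`, and `P` is a contraction. Such balls therefore contain all the points at which the radial
potential evaluates `S`. -/
lemma fibreScale_mem_ball {P : V →L[ℂ] V} (hP : ∀ v, ‖P v‖ ≤ ‖v‖) {p₀ : V} (hp₀ : P p₀ = p₀)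
    {r : ℝ} {p : V} (hp : p ∈ Metric.ball p₀ r) {t : ℝ} (ht : t ∈ Icc (0 : ℝ) 1) :
    fibreScale P t p ∈ Metric.ball p₀ r := by
  rw [mem_ball_iff_norm] at hp ⊢
  refine lt_of_le_of_lt ?_ hp
  have h : fibreScale P t p - p₀ = ((1 - t : ℝ) : ℂ) • P (p - p₀) + (t : ℂ) • (p - p₀) := by
    rw [fibreScale_apply, eulerField_apply, map_sub, hp₀]
    push_cast
    module
  rw [h]
  refine (norm_add_le _ _).trans ?_
  simp only [norm_smul, Complex.norm_real, Real.norm_eq_abs]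
  rw [abs_of_nonneg ht.1, abs_of_nonneg (sub_nonneg.2 ht.2)]
  nlinarith [hP (p - p₀), mul_le_mul_of_nonneg_left (hP (p - p₀)) (sub_nonneg.2 ht.2)]

/-- A form with values in bilinear maps is closed at `p`. -/
def IsClosedAt (S : V → V →L[ℂ] V →L[ℂ] ℂ) (p : V) : Prop :=
  ∀ a b c, fderiv ℂ S p a b c - fderiv ℂ S p b a c + fderiv ℂ S p c a b = 0

lemma fderiv_antisymm {S : V → V →L[ℂ] V →L[ℂ] ℂ} (hanti : ∀ p a b, S p a b = - S p b a) {p : V}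
    (hS : DifferentiableAt ℂ S p) (a b c : V) :
    fderiv ℂ S p a b c = - fderiv ℂ S p a c b := by
  have h : ∀ b c, HasFDerivAt (fun q => S q b c) (((fderiv ℂ S p).flip b).flip c) p := by
    intro b c
    refine ((hS.hasFDerivAt.clm_apply (hasFDerivAt_const b p)).clm_apply
      (hasFDerivAt_const c p)).congr_fderiv ?_
    ext
    simp
  have h1 := (h c b).neg.congr_of_eventuallyEq (Eventually.of_forall fun q => hanti q b c)
  simpa using congrArg (fun L => L a) ((h b c).unique h1)

/-- The 1-form `∫₀¹ m_t^* (ι_R S) dt / t`, where `m_t` is the fibrewise scaling and `R` is the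
Euler vector field. -/
def radialPotential (P : V →L[ℂ] V) (S : V → V →L[ℂ] V →L[ℂ] ℂ) (p w : V) : ℂ :=
  ∫ t in (0 : ℝ)..1, S (fibreScale P t p) (eulerField P p) (fibreScale P t w)

/-- The scalings, as a curve of linear maps. -/
def scaleCurve (P : V →L[ℂ] V) : C(TimeInterval, V →L[ℂ] V) :=
  ⟨fun t => fibreScale P (t : ℝ), (continuous_fibreScale P).comp
    (Complex.continuous_ofReal.comp continuous_subtype_val)⟩

lemma hasFDerivAt_radialIntegrand {P : V →L[ℂ] V} {S : V → V →L[ℂ] V →L[ℂ] ℂ} {p : V} {z : ℂ}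
    (hS : DifferentiableAt ℂ S (fibreScale P z p)) (w : V) :
    HasFDerivAt (fun q => S (fibreScale P z q) (eulerField P q) (fibreScale P z w))
      ((((fderiv ℂ S (fibreScale P z p)).flip (eulerField P p)).flip
          (fibreScale P z w)).comp (fibreScale P z) +
        ((S (fibreScale P z p)).flip (fibreScale P z w)).comp (eulerField P)) p := by
  have h1 : HasFDerivAt (fun q => S (fibreScale P z q))
      ((fderiv ℂ S (fibreScale P z p)).comp (fibreScale P z)) p :=
    HasFDerivAt.comp (g := S) p hS.hasFDerivAt (fibreScale P z).hasFDerivAt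
  have h2 := (h1.clm_apply (eulerField P).hasFDerivAt).clm_apply
    (hasFDerivAt_const (fibreScale P z w) p)
  refine h2.congr_fderiv ?_
  ext u
  all_goals simp [add_comm]

/-- By Cartan's formula, for closed antisymmetric `S` this derivative of $m_z^*S$ is the exterior
derivative of the integrand of `radialPotential`. That is why integrating over `[0, 1]` produces a
primitive of $m_1^*S-m_0^*S$. -/
lemma hasDerivAt_pullback_fibreScale {P : V →L[ℂ] V} {S : V → V →L[ℂ] V →L[ℂ] ℂ} {p : V} {z : ℂ}
    (hS : DifferentiableAt ℂ S (fibreScale P z p)) (u w : V) :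
    HasDerivAt (fun z => S (fibreScale P z p) (fibreScale P z u) (fibreScale P z w))
      (fderiv ℂ S (fibreScale P z p) (eulerField P p) (fibreScale P z u) (fibreScale P z w)
        + S (fibreScale P z p) (eulerField P u) (fibreScale P z w)
        + S (fibreScale P z p) (fibreScale P z u) (eulerField P w)) z := by
  have h1 := HasFDerivAt.comp_hasDerivAt (l := S) z hS.hasFDerivAt (hasDerivAt_fibreScale P p z)
  have h2 := (h1.clm_apply (hasDerivAt_fibreScale P u z)).clm_apply (hasDerivAt_fibreScale P w z)
  refine h2.congr_deriv ?_
  simp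

/-- The relative Poincaré lemma near a point of the zero section: if `S` is a closed 2-form that
vanishes along the zero section, then its radial potential is an analytic primitive of `S` that
vanishes to second order at the zero section. -/
theorem exists_analyticAt_radialPotential {P : V →L[ℂ] V} (hP : ∀ v, ‖P v‖ ≤ ‖v‖) {p₀ : V}
    (hp₀ : P p₀ = p₀) (hPP : ∀ v, P (P v) = P v)
    {S : V → V →L[ℂ] V →L[ℂ] ℂ} {r : ℝ}
    (hr : 0 < r)
    (hS : ∀ p ∈ Metric.ball p₀ r, AnalyticAt ℂ S p)
    (hcl : ∀ p ∈ Metric.ball p₀ r, IsClosedAt S p)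
    (hanti : ∀ p a b, S p a b = - S p b a)
    (hzero : ∀ p ∈ Metric.ball p₀ r, P p = p → S p = 0) :
    ∃ β : V → V →L[ℂ] ℂ, AnalyticAt ℂ β p₀ ∧ fderiv ℂ β p₀ = 0 ∧
      ∀ᶠ p in 𝓝 p₀, (∀ w, β p w = radialPotential P S p w) ∧
        ∀ u w, fderiv ℂ β p u w - fderiv ℂ β p w u = S p u w := by
  -- The curve $t\mapsto m_t p$ depends linearly on `p` and is constant for `p = p₀`, so the
  -- superposition result applies to `S` along it.
  let m : V →L[ℂ] C(TimeInterval, V) :=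
    (pointwiseBilinear TimeInterval (ContinuousLinearMap.id ℂ (V →L[ℂ] V))
      (scaleCurve P)).comp (ContinuousLinearMap.const ℂ TimeInterval)
  have hm : ∀ p t, m p t = fibreScale P (t : ℝ) p := fun _ _ => rfl
  have hm0 : m p₀ = ContinuousMap.const _ p₀ := by
    ext t
    exact fibreScale_eq_self hp₀ _
  obtain ⟨N, hN, hNS⟩ := exists_contDiffAt_superposition
    (hS _ (Metric.mem_ball_self hr)) m.contDiff.contDiffAt hm0
  let Q : V → C(TimeInterval, V →L[ℂ] ℂ) := fun p =>
    pointwiseBilinear TimeInterval (ContinuousLinearMap.compL ℂ V V ℂ)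
      (pointwiseBilinear TimeInterval (ContinuousLinearMap.id ℂ (V →L[ℂ] V →L[ℂ] ℂ))
        (N p) (ContinuousLinearMap.const ℂ TimeInterval (eulerField P p))) (scaleCurve P)
  have hQ : ∀ p t w, Q p t w = N p t (eulerField P p) (fibreScale P (t : ℝ) w) :=
    fun _ _ _ => rfl
  have hQan : ContDiffAt ℂ ω Q p₀ :=
    contDiffAt_pointwiseBilinear _ (contDiffAt_pointwiseBilinear _ hN
      ((ContinuousLinearMap.const ℂ TimeInterval).comp (eulerField P)).contDiff.contDiffAt)
      contDiffAt_const
  let I := unitIntegral (V →L[ℂ] ℂ)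
  have hI : ∀ ξ w, I ξ w = ∫ t in (0 : ℝ)..1, extendCurve ξ t w := unitIntegral_apply_apply
  have hIcc : ∀ t ∈ Icc (0 : ℝ) 1, t ∈ Icc (-1 : ℝ) 2 := fun t ht =>
    ⟨by linarith [ht.1], by linarith [ht.2]⟩
  have hball : ∀ᶠ p in 𝓝 p₀, p ∈ Metric.ball p₀ r :=
    Metric.ball_mem_nhds _ hr
  have hdiff := eventually_differentiableAt hQan
  have hform : ∀ᶠ p in 𝓝 p₀, ∀ u w, ∀ t (ht : t ∈ Icc (0 : ℝ) 1),
      extendCurve (fderiv ℂ Q p u) t w =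
        fderiv ℂ S (fibreScale P t p) (fibreScale P t u) (eulerField P p) (fibreScale P t w)
        + S (fibreScale P t p) (eulerField P u) (fibreScale P t w) := by
    filter_upwards [hNS.eventually_nhds, hball, hdiff] with p hp hpb hpd u w t ht
    rw [extendCurve_apply _ (hIcc t ht)]
    have h1 := (hasFDerivAt_eval hpd ⟨t, hIcc t ht⟩).clm_apply (hasFDerivAt_const w p)
    have h2 := hasFDerivAt_radialIntegrand (z := t)
      (hS _ (fibreScale_mem_ball hP hp₀ hpb ht)).differentiableAt w
    have h3 := (h2.congr_of_eventuallyEq (hp.mono fun q hq => by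
      change Q q ⟨t, hIcc t ht⟩ w = _
      rw [hQ, hq, hm])).unique h1
    simpa using (congrArg (fun L => L u) h3).symm
  have hfd : ∀ᶠ p in 𝓝 p₀,
      fderiv ℂ (fun p => I (Q p)) p = I.comp (fderiv ℂ Q p) := by
    filter_upwards [hdiff] with p hp
    exact (I.hasFDerivAt.comp (g := I) p hp.hasFDerivAt).fderiv
  refine ⟨fun p => I (Q p), (I.contDiff.contDiffAt.comp (g := I) _ hQan).analyticAt, ?_, ?_⟩
  · rw [hfd.self_of_nhds]
    ext1 u
    ext1 w
    -- Both terms of `hform` vanish at `p₀`: the first contains the Euler field, which is zero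
    -- there, and the second contains `S p₀ = 0`.
    rw [ContinuousLinearMap.comp_apply, hI, integral_congr (g := fun _ => (0 : ℂ))]
    · simp
    · intro t ht
      rw [uIcc_of_le zero_le_one] at ht
      simp only [hform.self_of_nhds u w t ht]
      simp [fibreScale_eq_self hp₀, eulerField_eq_zero hp₀, hzero p₀ (Metric.mem_ball_self hr) hp₀]
  · filter_upwards [hfd, hform, hNS, hball] with p hp hpf hpe hpb
    refine ⟨fun w => ?_, fun u w => ?_⟩
    · rw [hI]
      refine integral_congr fun t ht => ?_
      rw [uIcc_of_le zero_le_one] at ht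
      simp only [extendCurve_apply _ (hIcc t ht), hQ, hpe, hm]
    · have hcont : ∀ u w : V, Continuous fun t => extendCurve (fderiv ℂ Q p u) t w :=
        fun u w => (continuous_extendCurve _).clm_apply continuous_const
      rw [hp, ContinuousLinearMap.comp_apply, ContinuousLinearMap.comp_apply, hI, hI,
        ← integral_sub ((hcont u w).intervalIntegrable _ _) ((hcont w u).intervalIntegrable _ _)]
      -- The fundamental theorem of calculus for $t\mapsto m_t^*S$: the value at `1` is `S`, and the
      -- value at `0` vanishes because $m_0=P$ maps into the zero section.
      rw [integral_eq_sub_of_hasDerivAt (f := fun t : ℝ =>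
        S (fibreScale P t p) (fibreScale P t u) (fibreScale P t w))]
      · have h0 : S (fibreScale P (0 : ℝ) p) = 0 := by
          have := fibreScale_mem_ball hP hp₀ hpb (left_mem_Icc.2 zero_le_one)
          rw [Complex.ofReal_zero, fibreScale_zero] at this ⊢
          exact hzero _ this (hPP p)
        rw [h0]
        simp [fibreScale_one]
      · intro t ht
        rw [uIcc_of_le zero_le_one] at ht
        have hb := fibreScale_mem_ball hP hp₀ hpb ht
        refine (hasDerivAt_pullback_fibreScale (hS _ hb).differentiableAt u w).comp_ofReal.congr_deriv
          ?_
        rw [hpf u w t ht, hpf w u t ht]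
        have h1 := hcl _ hb (fibreScale P t u) (eulerField P p) (fibreScale P t w)
        have h2 : fderiv ℂ S (fibreScale P t p) (fibreScale P t w) (eulerField P p)
            (fibreScale P t u) = - fderiv ℂ S (fibreScale P t p) (fibreScale P t w)
              (fibreScale P t u) (eulerField P p) := by
          exact fderiv_antisymm hanti (hS _ hb).differentiableAt _ _ _
        rw [h2, hanti _ (fibreScale P t u) (eulerField P w)]
        linear_combination (-1 : ℂ) * h1
      · exact ((hcont u w).sub (hcont w u)).intervalIntegrable _ _

end Poincare

end HoloDW

namespace HoloDW

open Filter Topology MeasureTheory intervalIntegral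

/-! ### Existence and analytic dependence of the Moser flow -/

section MoserVelocity

variable {V : Type*} [NormedAddCommGroup V] [NormedSpace ℂ V]
  {D : Type*} [NormedAddCommGroup D] [NormedSpace ℂ D]

/-- The curve with a given initial point and velocity. -/
def curveOfVelocity (V : Type*) [NormedAddCommGroup V] [NormedSpace ℂ V] :
    V × C(TimeInterval, V) →L[ℂ] C(TimeInterval, V) :=
  (ContinuousLinearMap.const ℂ TimeInterval).comp (ContinuousLinearMap.fst ℂ V C(TimeInterval, V)) +
    (primitive V).comp (ContinuousLinearMap.snd ℂ V C(TimeInterval, V))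

lemma curveOfVelocity_apply (x : V × C(TimeInterval, V)) (s : TimeInterval) :
    curveOfVelocity V x s = x.1 + primitive V x.2 s := rfl

lemma curveOfVelocity_zero (p : V) :
    curveOfVelocity V (p, 0) = ContinuousMap.const TimeInterval p := by
  ext s
  simp [curveOfVelocity_apply]

/-- The inclusion of the time interval into `ℂ`. -/
def complexTime : C(TimeInterval, ℂ) :=
  ⟨fun t => ((t : ℝ) : ℂ), Complex.continuous_ofReal.comp continuous_subtype_val⟩

/-- The left hand side of Moser's equation as an operator on initial points and velocities. -/
lemma exists_moserOperator [CompleteSpace D] {A S : V → V →L[ℂ] D} {β : V → D} {p₀ : V}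
    (hA : AnalyticAt ℂ A p₀) (hS : AnalyticAt ℂ S p₀) (hβ : AnalyticAt ℂ β p₀) :
    ∃ G : V × C(TimeInterval, V) → C(TimeInterval, D), ContDiffAt ℂ ω G (p₀, 0) ∧
      ∀ᶠ x in 𝓝 ((p₀, 0) : V × C(TimeInterval, V)), ∀ s : TimeInterval, G x s =
        (A (curveOfVelocity V x s) + ((s : ℝ) : ℂ) • S (curveOfVelocity V x s)) (x.2 s) +
          β (curveOfVelocity V x s) := by
  have hc : ContDiffAt ℂ ω (curveOfVelocity V) (p₀, 0) :=
    (curveOfVelocity V).contDiff.contDiffAt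
  obtain ⟨NA, hNA, hNA'⟩ := exists_contDiffAt_superposition hA hc (curveOfVelocity_zero p₀)
  obtain ⟨NS, hNS, hNS'⟩ := exists_contDiffAt_superposition hS hc (curveOfVelocity_zero p₀)
  obtain ⟨Nβ, hNβ, hNβ'⟩ := exists_contDiffAt_superposition hβ hc (curveOfVelocity_zero p₀)
  refine ⟨fun x => pointwiseBilinear TimeInterval (ContinuousLinearMap.id ℂ (V →L[ℂ] D))
    (NA x + pointwiseBilinear TimeInterval (ContinuousLinearMap.lsmul ℂ ℂ) complexTime (NS x)) x.2
      + Nβ x, ?_, ?_⟩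
  · exact (contDiffAt_pointwiseBilinear _ (hNA.add (contDiffAt_pointwiseBilinear _
      contDiffAt_const hNS)) contDiffAt_snd).add hNβ
  · filter_upwards [hNA', hNS', hNβ'] with x h1 h2 h3 s
    rw [← h1, ← h2, ← h3]
    rfl

/-- The derivatives of `A` and `S` are applied to the velocity, which is zero at the base point; `S
p₀` and the derivative of `β` vanish by hypothesis. Only `A p₀` acting on the variation of the
velocity survives, and the initial point does not contribute. -/
lemma hasFDerivAt_moserOperator [CompleteSpace D] {A S : V → V →L[ℂ] D} {β : V → D} {p₀ : V}
    (hA : AnalyticAt ℂ A p₀) (hS : AnalyticAt ℂ S p₀) (hβ : AnalyticAt ℂ β p₀) (hS0 : S p₀ = 0)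
    (hDβ : fderiv ℂ β p₀ = 0) {G : V × C(TimeInterval, V) → C(TimeInterval, D)}
    (hG : ContDiffAt ℂ ω G (p₀, 0))
    (hG' : ∀ᶠ x in 𝓝 ((p₀, 0) : V × C(TimeInterval, V)), ∀ s : TimeInterval, G x s =
        (A (curveOfVelocity V x s) + ((s : ℝ) : ℂ) • S (curveOfVelocity V x s)) (x.2 s) +
          β (curveOfVelocity V x s)) (x : V × C(TimeInterval, V)) (s : TimeInterval) :
    fderiv ℂ G (p₀, 0) x s = A p₀ (x.2 s) := by
  let x₀ : V × C(TimeInterval, V) := (p₀, 0)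
  let c : V × C(TimeInterval, V) →L[ℂ] V := (ContinuousMap.evalCLM ℂ s).comp (curveOfVelocity V)
  let ev : V × C(TimeInterval, V) →L[ℂ] V :=
    (ContinuousMap.evalCLM ℂ s).comp (ContinuousLinearMap.snd ℂ V C(TimeInterval, V))
  have hc0 : c x₀ = p₀ := by
    change curveOfVelocity V (p₀, 0) s = p₀
    rw [curveOfVelocity_zero]
    rfl
  have hA1 : HasFDerivAt A (fderiv ℂ A p₀) (c x₀) := by
    rw [hc0]; exact hA.differentiableAt.hasFDerivAt
  have hS1 : HasFDerivAt S (fderiv ℂ S p₀) (c x₀) := by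
    rw [hc0]; exact hS.differentiableAt.hasFDerivAt
  have hβ1 : HasFDerivAt β (0 : V →L[ℂ] D) (c x₀) := by
    rw [hc0, ← hDβ]; exact hβ.differentiableAt.hasFDerivAt
  have h1 := ((((HasFDerivAt.comp (g := A) x₀ hA1 c.hasFDerivAt).add
    ((HasFDerivAt.comp (g := S) x₀ hS1 c.hasFDerivAt).const_smul ((s : ℝ) : ℂ))).clm_apply
    ev.hasFDerivAt).add (HasFDerivAt.comp (g := β) x₀ hβ1 c.hasFDerivAt)).congr_of_eventuallyEq
    (f₁ := fun x => G x s) (hG'.mono fun x hx => hx s)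
  have h2 := hasFDerivAt_eval (hG.differentiableAt (by simp)) s
  have h3 := congrArg (fun L => L x) (h2.unique h1)
  have hev0 : ev x₀ = 0 := rfl
  simp [hc0, hS0, hev0] at h3
  exact h3

/-- Moser's equation `(A + s S) ξ_s + β = 0` along the curve with velocity `ξ` has a solution that
depends analytically on the initial point, near a point where `S` and the 1-jet of `β` vanish. -/
theorem exists_moserVelocity [CompleteSpace V] [CompleteSpace D]
    {A S : V → V →L[ℂ] D} {β : V → D} {p₀ : V}
    (hA : AnalyticAt ℂ A p₀) (hS : AnalyticAt ℂ S p₀) (hβ : AnalyticAt ℂ β p₀) (hS0 : S p₀ = 0)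
    (hβ0 : β p₀ = 0) (hDβ : fderiv ℂ β p₀ = 0) (e : V ≃L[ℂ] D) (he : (e : V →L[ℂ] D) = A p₀) :
    ∃ ξ : V → C(TimeInterval, V), AnalyticAt ℂ ξ p₀ ∧ ξ p₀ = 0 ∧
      (∀ᶠ p in 𝓝 p₀, β p = 0 → ξ p = 0) ∧
      ∀ᶠ p in 𝓝 p₀, ∀ s : TimeInterval,
        (A (curveOfVelocity V (p, ξ p) s) + ((s : ℝ) : ℂ) • S (curveOfVelocity V (p, ξ p) s))
          (ξ p s) + β (curveOfVelocity V (p, ξ p) s) = 0 := by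
  obtain ⟨G, hG, hG'⟩ := exists_moserOperator hA hS hβ
  let T : C(TimeInterval, D) →L[ℂ] C(TimeInterval, V) :=
    (e.symm : D →L[ℂ] V).compLeftContinuous ℂ TimeInterval
  have hT : ∀ δ s, T δ s = e.symm (δ s) := fun _ _ => rfl
  -- With `T` inverting `A p₀` pointwise, the derivative of `Ψ` at `(p₀, 0)` is the identity.
  -- Moser's equation for the initial point `p` becomes `Ψ x = (p, 0)`, solved by the local inverse.
  let Ψ : V × C(TimeInterval, V) → V × C(TimeInterval, V) := fun x => (x.1, T (G x))
  have hTG : ContDiffAt ℂ ω (fun x => T (G x)) (p₀, 0) :=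
    T.contDiff.contDiffAt.comp (g := T) _ hG
  have hΨ : ContDiffAt ℂ ω Ψ (p₀, 0) := contDiffAt_fst.prodMk hTG
  have hTG' : HasFDerivAt (fun x => T (G x)) (ContinuousLinearMap.snd ℂ V C(TimeInterval, V))
      (p₀, 0) := by
    refine (T.hasFDerivAt.comp (g := T) _
      (hG.differentiableAt (by simp)).hasFDerivAt).congr_fderiv ?_
    refine ContinuousLinearMap.ext fun x => ?_
    ext s
    rw [ContinuousLinearMap.comp_apply, hT, hasFDerivAt_moserOperator hA hS hβ hS0 hDβ hG hG', ← he]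
    exact e.symm_apply_apply _
  have hΨ' : HasFDerivAt Ψ ((ContinuousLinearEquiv.refl ℂ (V × C(TimeInterval, V)) :
      V × C(TimeInterval, V) →L[ℂ] V × C(TimeInterval, V))) (p₀, 0) :=
    hasFDerivAt_fst.prodMk hTG'
  -- Where `β` vanishes, the constant curve solves the equation; local injectivity of `Ψ` will force
  -- it to be the chosen solution. This is what fixes the zero section pointwise.
  have hG0 : ∀ᶠ p in 𝓝 p₀, β p = 0 → Ψ (p, 0) = (p, 0) := by
    have : Tendsto (fun p : V => ((p, 0) : V × C(TimeInterval, V))) (𝓝 p₀) (𝓝 (p₀, 0)) :=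
      Continuous.tendsto (by fun_prop) p₀
    filter_upwards [this.eventually hG'] with p hp hβp
    refine Prod.ext rfl ?_
    ext s
    change T (G (p, 0)) s = 0
    rw [hT, hp s, curveOfVelocity_zero]
    simp [hβp]
  have hΨ0 : Ψ (p₀, 0) = (p₀, 0) := hG0.self_of_nhds hβ0
  let Θ := hΨ.localInverse hΨ' (by simp)
  have hΘ0 : Θ (p₀, 0) = (p₀, 0) := by
    have := hΨ.localInverse_apply_image hΨ' (by simp)
    rwa [hΨ0] at this
  have hΘ : ContDiffAt ℂ ω Θ (p₀, 0) := by
    have := hΨ.to_localInverse hΨ' (by simp)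
    rwa [hΨ0] at this
  have hl := (hΨ.hasStrictFDerivAt' hΨ' (by simp)).eventually_left_inverse
  have hrr := (hΨ.hasStrictFDerivAt' hΨ' (by simp)).eventually_right_inverse
  rw [hΨ0] at hrr
  have hi : ContDiffAt ℂ ω (fun p : V => ((p, 0) : V × C(TimeInterval, V))) p₀ :=
    contDiffAt_id.prodMk contDiffAt_const
  have hΘi : ContDiffAt ℂ ω (fun p : V => Θ (p, 0)) p₀ := hΘ.comp (g := Θ) p₀ hi
  refine ⟨fun p => (Θ (p, 0)).2, (contDiffAt_snd.comp (g := Prod.snd) p₀ hΘi).analyticAt,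
    by simp [hΘ0], ?_, ?_⟩
  · filter_upwards [hG0, hi.continuousAt.eventually hl] with p hp hpl hβp
    have h : Θ (Ψ (p, 0)) = (p, 0) := hpl
    rw [hp hβp] at h
    rw [h]
  · have hcont : Tendsto (fun p : V => Θ (p, 0)) (𝓝 p₀) (𝓝 (p₀, 0)) := by
      have := hΘi.continuousAt.tendsto
      rwa [hΘ0] at this
    filter_upwards [hi.continuousAt.eventually hrr, hcont.eventually hG'] with p hp hpG s
    have h : Ψ (Θ (p, 0)) = (p, 0) := hp
    have h1 : (Θ (p, 0)).1 = p := congrArg Prod.fst h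
    have h2 : T (G (Θ (p, 0))) = 0 := congrArg Prod.snd h
    have h3 : ((p, (Θ (p, 0)).2) : V × C(TimeInterval, V)) = Θ (p, 0) :=
      Prod.ext h1.symm rfl
    rw [h3, ← hpG s]
    have h4 : e.symm (G (Θ (p, 0)) s) = 0 := by
      rw [← hT, h2]; rfl
    simpa using h4

end MoserVelocity

end HoloDW

namespace HoloDW

open Filter Topology MeasureTheory intervalIntegral

/-! ### Invariance of the forms along the Moser flow -/

section MoserPullback

variable {V : Type*} [NormedAddCommGroup V] [NormedSpace ℂ V]

/-- The derivative of Moser's equation with respect to the initial point. -/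
lemma fderiv_moserEquation [CompleteSpace V] {D : Type*} [NormedAddCommGroup D] [NormedSpace ℂ D]
    {A S : V → V →L[ℂ] D} {β : V → D}
    {ξ : V → C(TimeInterval, V)} {p : V} (hξ : DifferentiableAt ℂ ξ p) {s : TimeInterval}
    (heq : ∀ᶠ q in 𝓝 p,
      (A (curveOfVelocity V (q, ξ q) s) + ((s : ℝ) : ℂ) • S (curveOfVelocity V (q, ξ q) s))
          (ξ q s) + β (curveOfVelocity V (q, ξ q) s) = 0)
    (hA : DifferentiableAt ℂ A (curveOfVelocity V (p, ξ p) s))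
    (hS : DifferentiableAt ℂ S (curveOfVelocity V (p, ξ p) s))
    (hβ : DifferentiableAt ℂ β (curveOfVelocity V (p, ξ p) s)) (u : V) :
    let x := curveOfVelocity V (p, ξ p) s
    let η := curveOfVelocity V (u, fderiv ℂ ξ p u) s
    (fderiv ℂ A x η + ((s : ℝ) : ℂ) • fderiv ℂ S x η) (ξ p s)
      + (A x + ((s : ℝ) : ℂ) • S x) (fderiv ℂ ξ p u s) + fderiv ℂ β x η = 0 := by
  intro x η
  let c : V → V := fun q => curveOfVelocity V (q, ξ q) s
  let ev : C(TimeInterval, V) →L[ℂ] V := ContinuousMap.evalCLM ℂ s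
  let c' : V →L[ℂ] V := (ev.comp (curveOfVelocity V)).comp
    ((ContinuousLinearMap.id ℂ V).prod (fderiv ℂ ξ p))
  have hc : HasFDerivAt c c' p :=
    HasFDerivAt.comp (g := ev.comp (curveOfVelocity V)) p
      (ev.comp (curveOfVelocity V)).hasFDerivAt ((hasFDerivAt_id p).prodMk hξ.hasFDerivAt)
  have h1 := ((((HasFDerivAt.comp (g := A) p hA.hasFDerivAt hc).add
    ((HasFDerivAt.comp (g := S) p hS.hasFDerivAt hc).const_smul ((s : ℝ) : ℂ))).clm_apply
    (hasFDerivAt_eval hξ s)).add (HasFDerivAt.comp (g := β) p hβ.hasFDerivAt hc))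
  have h2 := h1.congr_of_eventuallyEq (f₁ := fun _ => 0) (heq.mono fun q hq => hq.symm)
  have h3 := congrArg (fun L => L u) (h2.unique (hasFDerivAt_const (0 : D) p))
  have hcp : c p = x := rfl
  have hc'u : c' u = η := rfl
  simp [hcp, hc'u] at h3
  rw [← h3]
  simp
  abel

/-- The chain rule for a complex differentiable map along a real curve. -/
lemma hasDerivAt_comp_curve {W : Type*} [NormedAddCommGroup W] [NormedSpace ℂ W] {f : V → W}
    {f' : V →L[ℂ] W} {c : ℝ → V} {c' : V} {t : ℝ} (hf : HasFDerivAt f f' (c t))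
    (hc : HasDerivAt c c' t) : HasDerivAt (fun t => f (c t)) (f' c') t :=
  HasFDerivAt.comp_hasDerivAt (l := f) t (hf.restrictScalars ℝ) hc

lemma hasDerivAt_bilinear_curve {A : V → V →L[ℂ] V →L[ℂ] ℂ} {c a b : ℝ → V} {c' a' b' : V} {t : ℝ}
    (hA : DifferentiableAt ℂ A (c t)) (hc : HasDerivAt c c' t) (ha : HasDerivAt a a' t)
    (hb : HasDerivAt b b' t) :
    HasDerivAt (fun t => A (c t) (a t) (b t))
      (fderiv ℂ A (c t) c' (a t) (b t) + A (c t) a' (b t) + A (c t) (a t) b') t := by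
  let π₁ := ContinuousLinearMap.fst ℂ V (V × V)
  let π₂ := (ContinuousLinearMap.fst ℂ V V).comp (ContinuousLinearMap.snd ℂ V (V × V))
  let π₃ := (ContinuousLinearMap.snd ℂ V V).comp (ContinuousLinearMap.snd ℂ V (V × V))
  have h0 : HasFDerivAt A (fderiv ℂ A (c t)) (π₁ (c t, a t, b t)) := hA.hasFDerivAt
  have h1 := ((HasFDerivAt.comp (g := A) (c t, a t, b t) h0 π₁.hasFDerivAt).clm_apply
    π₂.hasFDerivAt).clm_apply π₃.hasFDerivAt
  refine (hasDerivAt_comp_curve (c := fun t => (c t, a t, b t)) h1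
    (hc.prodMk (ha.prodMk hb))).congr_deriv ?_
  simp [π₁, π₂, π₃]
  ring

lemma hasDerivAt_curveOfVelocity [CompleteSpace V] (x : V × C(TimeInterval, V)) {t : ℝ}
    (ht : t ∈ Ioo (-1 : ℝ) 2) :
    HasDerivAt (extendCurve (curveOfVelocity V x)) (extendCurve x.2 t) t := by
  refine ((hasDerivAt_extendCurve_primitive x.2 ht).const_add x.1).congr_of_eventuallyEq ?_
  filter_upwards with s
  rfl

/-- The Moser flow pulls back the form `A + S` at time `1` to the form `A`. -/
theorem moser_pullback [CompleteSpace V] {A S : V → V →L[ℂ] V →L[ℂ] ℂ} {β : V → V →L[ℂ] ℂ}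
    (hAanti : ∀ p a b, A p a b = - A p b a) (hSanti : ∀ p a b, S p a b = - S p b a)
    {R : Set V} (hA : ∀ p ∈ R, DifferentiableAt ℂ A p) (hS : ∀ p ∈ R, DifferentiableAt ℂ S p)
    (hβ : ∀ p ∈ R, DifferentiableAt ℂ β p)
    (hAcl : ∀ p ∈ R, IsClosedAt A p) (hScl : ∀ p ∈ R, IsClosedAt S p)
    (hdβ : ∀ p ∈ R, ∀ u w, fderiv ℂ β p u w - fderiv ℂ β p w u = S p u w)
    {ξ : V → C(TimeInterval, V)} {p : V} (hξ : DifferentiableAt ℂ ξ p)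
    (heq : ∀ᶠ q in 𝓝 p, ∀ s : TimeInterval,
      (A (curveOfVelocity V (q, ξ q) s) + ((s : ℝ) : ℂ) • S (curveOfVelocity V (q, ξ q) s))
          (ξ q s) + β (curveOfVelocity V (q, ξ q) s) = 0)
    (hR : ∀ s : TimeInterval, curveOfVelocity V (p, ξ p) s ∈ R) (u w : V) :
    let η : V → V := fun u => extendCurve (curveOfVelocity V (u, fderiv ℂ ξ p u)) 1
    (A (extendCurve (curveOfVelocity V (p, ξ p)) 1) +
      S (extendCurve (curveOfVelocity V (p, ξ p)) 1)) (η u) (η w) = A p u w := by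
  intro η₁
  let c : ℝ → V := extendCurve (curveOfVelocity V (p, ξ p))
  let η : V → ℝ → V := fun u => extendCurve (curveOfVelocity V (u, fderiv ℂ ξ p u))
  -- Here `η u` is the derivative of the flow in the direction `u` of the initial point, so `f` is
  -- the pullback of `A + t S` evaluated at `u, w`. It is constant in `t`.
  let f : ℝ → ℂ := fun t => (A (c t) + (t : ℂ) • S (c t)) (η u t) (η w t)
  have hf : ∀ t ∈ Ioo (-1 : ℝ) 2, HasDerivAt f 0 t := by
    intro t ht
    have htI := Ioo_subset_Icc_self ht
    have hcR : c t ∈ R := hR _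
    have hc : HasDerivAt c (extendCurve (ξ p) t) t := hasDerivAt_curveOfVelocity _ ht
    have hη : ∀ u, HasDerivAt (η u) (extendCurve (fderiv ℂ ξ p u) t) t :=
      fun u => hasDerivAt_curveOfVelocity _ ht
    have h1 := hasDerivAt_bilinear_curve (hA _ hcR) hc (hη u) (hη w)
    have h2 := (Complex.ofRealCLM.hasDerivAt (x := t)).mul
      (hasDerivAt_bilinear_curve (hS _ hcR) hc (hη u) (hη w))
    refine (h1.add h2).congr_deriv ?_
    have hlin : ∀ u, _ := fderiv_moserEquation hξ (heq.mono fun q hq => hq ⟨t, htI⟩)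
      (hA _ (hR _)) (hS _ (hR _)) (hβ _ (hR _))
    have hx : curveOfVelocity V (p, ξ p) ⟨t, htI⟩ = c t := (extendCurve_apply _ htI).symm
    have hη' : ∀ u, curveOfVelocity V (u, fderiv ℂ ξ p u) ⟨t, htI⟩ = η u t :=
      fun u => (extendCurve_apply _ htI).symm
    simp only [hx, hη', ← extendCurve_apply _ htI] at hlin
    have hu := congrArg (fun L => L (η w t)) (hlin u)
    have hw := congrArg (fun L => L (η u t)) (hlin w)
    simp only [add_apply, smul_apply, smul_eq_mul,
      zero_apply] at hu hw
    have hd := hdβ _ hcR (η u t) (η w t)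
    have hA3 := hAcl _ hcR (extendCurve (ξ p) t) (η u t) (η w t)
    have hS3 := hScl _ hcR (extendCurve (ξ p) t) (η u t) (η w t)
    rw [hAanti (c t) (η u t), hSanti (c t) (η u t) (extendCurve (fderiv ℂ ξ p w) t)]
    simp only [Complex.ofRealCLM_apply, Complex.ofReal_one]
    -- Moser's cancellation: antisymmetrising the linearised equation produces $d\beta$, which
    -- equals `S` and cancels the derivative of the factor `t`; closedness of `A` and `S` removes
    -- the terms with derivatives of the forms.
    linear_combination hu - hw - hd + hA3 + (t : ℂ) * hS3
  have h01 : f 1 = f 0 := by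
    have := integral_eq_sub_of_hasDerivAt (f := f) (f' := fun _ => 0) (a := 0) (b := 1)
      (fun t ht => by
        rw [uIcc_of_le zero_le_one] at ht
        exact hf t ⟨by linarith [ht.1], by linarith [ht.2]⟩) intervalIntegrable_const
    rw [intervalIntegral.integral_zero] at this
    exact (sub_eq_zero.1 this.symm)
  have h0 : ∀ x : V × C(TimeInterval, V), extendCurve (curveOfVelocity V x) 0 = x.1 := by
    intro x
    rw [extendCurve_apply _ (by norm_num), curveOfVelocity_apply, primitive_apply]
    simp
  simp only [f, c, η, h0] at h01
  simpa using h01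

end MoserPullback

end HoloDW

namespace HoloDW

open Filter Topology MeasureTheory intervalIntegral

/-! ### The local Moser flow at a point of the zero section -/

section LocalMoser

variable {V : Type*} [NormedAddCommGroup V] [NormedSpace ℂ V]

/-- `A` and `A + S` are closed analytic 2-forms on the open set `O`, given as fields of bilinear
maps, that agree at the fixed points of the projection `P`. -/
structure IsMoserPair (P : V →L[ℂ] V) (A S : V → V →L[ℂ] V →L[ℂ] ℂ) (O : Set V) : Prop where
  isOpen : IsOpen O
  norm_le : ∀ v, ‖P v‖ ≤ ‖v‖
  idem : ∀ v, P (P v) = P v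
  analytic_left : ∀ p ∈ O, AnalyticAt ℂ A p
  analytic_right : ∀ p ∈ O, AnalyticAt ℂ S p
  closed_left : ∀ p ∈ O, IsClosedAt A p
  closed_right : ∀ p ∈ O, IsClosedAt S p
  anti_left : ∀ p a b, A p a b = - A p b a
  anti_right : ∀ p a b, S p a b = - S p b a
  zero : ∀ p ∈ O, P p = p → S p = 0

/-- The vector `v` satisfies Moser's equation `(A + t S)(v, ·) = -β` at `p`, where `β` is the
radial potential of `S`. -/
def MoserEquation (P : V →L[ℂ] V) (A S : V → V →L[ℂ] V →L[ℂ] ℂ) (t : ℝ) (p v : V) : Prop :=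
  ∀ w, A p v w + (t : ℂ) * S p v w = - radialPotential P S p w

/-- A time-dependent vector field on `R` for which integral curves are locally unique. -/
def IsLocallyLipschitz (X : ℝ → V → V) (R : Set V) : Prop :=
  ∀ t ∈ Ioo (-1 : ℝ) 2, ∀ p ∈ R, ∃ K, ∃ s ∈ 𝓝 p, ∀ᶠ t' in 𝓝 t, LipschitzOnWith K (X t') s

/-- `Φ` is an analytic flow on `N` of the time-dependent vector field `X` on `R`. It fixes the
fixed points of `P`, and its time-`1` map pulls back `A + S` to `A`. -/
structure IsMoserFlow (P : V →L[ℂ] V) (A S : V → V →L[ℂ] V →L[ℂ] ℂ) (X : ℝ → V → V) (R N : Set V)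
    (Φ : V → ℝ → V) : Prop where
  initial : ∀ p ∈ N, Φ p 0 = p
  mem : ∀ p ∈ N, ∀ t ∈ Ioo (-1 : ℝ) 2, Φ p t ∈ R
  deriv : ∀ p ∈ N, ∀ t ∈ Ioo (-1 : ℝ) 2, HasDerivAt (Φ p) (X t (Φ p t)) t
  fix : ∀ p ∈ N, P p = p → Φ p 1 = p
  analytic : ∀ p ∈ N, AnalyticAt ℂ (fun q => Φ q 1) p
  pullback : ∀ p ∈ N, ∀ u w, (A (Φ p 1) + S (Φ p 1)) (fderiv ℂ (fun q => Φ q 1) p u)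
    (fderiv ℂ (fun q => Φ q 1) p w) = A p u w

/-- Inversion is analytic at invertible operators, so the field is analytic jointly in the point and
a complexified time. Being $C^1$ in the pair, it has one Lipschitz constant for all nearby times. -/
lemma exists_lipschitzOnWith_moserField [CompleteSpace V] {D : Type*} [NormedAddCommGroup D]
    [NormedSpace ℂ D] [CompleteSpace D] {A S : V → V →L[ℂ] D} {β : V → D} {p : V} {t : ℝ}
    (hA : AnalyticAt ℂ A p) (hS : AnalyticAt ℂ S p) (hβ : AnalyticAt ℂ β p) (e : V ≃L[ℂ] D)
    (he : (e : V →L[ℂ] D) = A p + (t : ℂ) • S p) :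
    ∃ K, ∃ s ∈ 𝓝 p, ∀ᶠ t' : ℝ in 𝓝 t,
      LipschitzOnWith K (fun q => -(A q + (t' : ℂ) • S q).inverse (β q)) s := by
  let Y : ℂ × V → V := fun x => -(A x.2 + x.1 • S x.2).inverse (β x.2)
  have h2 : ContDiffAt ℂ ω (fun x : ℂ × V => x.2) ((t : ℂ), p) := contDiffAt_snd
  have h1 : ContDiffAt ℂ ω (fun x : ℂ × V => A x.2 + x.1 • S x.2) ((t : ℂ), p) :=
    (hA.contDiffAt.comp (g := A) _ h2).add
      (contDiffAt_fst.smul (hS.contDiffAt.comp (g := S) _ h2))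
  have h3 : ContDiffAt ℂ ω (ContinuousLinearMap.inverse : (V →L[ℂ] D) → D →L[ℂ] V)
      (A p + (t : ℂ) • S p) := by
    rw [← he]; exact contDiffAt_map_inverse e
  have hY : ContDiffAt ℂ ω Y ((t : ℂ), p) :=
    ((h3.comp (g := ContinuousLinearMap.inverse) ((t : ℂ), p) h1).clm_apply
      (hβ.contDiffAt.comp (g := β) _ h2)).neg
  have hY' : ContDiffAt ℝ 1 (fun x : ℝ × V => Y ((x.1 : ℂ), x.2)) (t, p) := by
    refine ContDiffAt.comp (g := Y) (f := fun x : ℝ × V => ((x.1 : ℂ), x.2)) (t, p)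
      ((hY.restrict_scalars ℝ).of_le le_top) ?_
    exact (Complex.ofRealCLM.contDiff.contDiffAt.comp (g := Complex.ofRealCLM) (t, p)
      contDiffAt_fst).prodMk contDiffAt_snd
  obtain ⟨K, s, hs, hK⟩ := hY'.exists_lipschitzOnWith
  obtain ⟨a, ha, b, hb, hab⟩ := mem_nhds_prod_iff.1 hs
  refine ⟨K, b, hb, ?_⟩
  filter_upwards [ha] with t' ht' q hq q' hq'
  have := hK (hab (mk_mem_prod ht' hq)) (hab (mk_mem_prod ht' hq'))
  simpa [Prod.edist_eq, Y] using this

/-- At `p₀` the operator is the invertible `A p₀` for every `t`. Invertibility is an open condition,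
and compactness of the time interval yields one neighbourhood for all times. -/
lemma eventually_forall_mem_range_equiv [CompleteSpace V] {D : Type*} [NormedAddCommGroup D]
    [NormedSpace ℂ D] [CompleteSpace D] {A S : V → V →L[ℂ] D} {p₀ : V}
    (hA : ContinuousAt A p₀) (hS : ContinuousAt S p₀) (hS0 : S p₀ = 0) (e : V ≃L[ℂ] D)
    (he : (e : V →L[ℂ] D) = A p₀) :
    ∀ᶠ p in 𝓝 p₀, ∀ t ∈ Icc (-1 : ℝ) 2,
      A p + (t : ℂ) • S p ∈ range ((↑) : (V ≃L[ℂ] D) → V →L[ℂ] D) := by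
  refine isCompact_Icc.eventually_forall_of_forall_eventually fun t _ => ?_
  have hcont : ContinuousAt (fun x : V × ℝ => A x.1 + (x.2 : ℂ) • S x.1) (p₀, t) := by
    refine ContinuousAt.add ?_ (ContinuousAt.smul
      (Complex.continuous_ofReal.comp continuous_snd).continuousAt ?_)
    · exact ContinuousAt.comp (g := A) (f := Prod.fst) hA continuousAt_fst
    · exact ContinuousAt.comp (g := S) (f := Prod.fst) hS continuousAt_fst
  have h0 : A p₀ + (t : ℂ) • S p₀ = e := by rw [hS0, smul_zero, add_zero, he]
  refine hcont.eventually ?_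
  simp only [h0]
  exact e.nhds

/-- The local form of the Darboux–Weinstein theorem. -/
theorem exists_moserFlow [CompleteSpace V] {P : V →L[ℂ] V} {A S : V → V →L[ℂ] V →L[ℂ] ℂ} {O : Set V}
    (h : IsMoserPair P A S O) {p₀ : V} (hp₀ : p₀ ∈ O) (hPp₀ : P p₀ = p₀)
    (e : V ≃L[ℂ] V →L[ℂ] ℂ) (he : (e : V →L[ℂ] V →L[ℂ] ℂ) = A p₀) :
    ∃ r > 0, Metric.ball p₀ r ⊆ O ∧ ∃ X : ℝ → V → V,
      (∀ t ∈ Ioo (-1 : ℝ) 2, ∀ p ∈ Metric.ball p₀ r, ∀ v, MoserEquation P A S t p v ↔ v = X t p) ∧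
      IsLocallyLipschitz X (Metric.ball p₀ r) ∧
      ∃ N ⊆ Metric.ball p₀ r, IsOpen N ∧ p₀ ∈ N ∧
        ∃ Φ, IsMoserFlow P A S X (Metric.ball p₀ r) N Φ := by
  obtain ⟨r₀, hr₀, hr₀O⟩ := Metric.isOpen_iff.1 h.isOpen p₀ hp₀
  obtain ⟨β, hβ, hDβ, hβ'⟩ := exists_analyticAt_radialPotential h.norm_le hPp₀ h.idem hr₀
    (fun p hp => h.analytic_right p (hr₀O hp)) (fun p hp => h.closed_right p (hr₀O hp))
    h.anti_right (fun p hp => h.zero p (hr₀O hp))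
  have hS0 : S p₀ = 0 := h.zero p₀ hp₀ hPp₀
  have hβfix : ∀ p, P p = p → (∀ w, β p w = radialPotential P S p w) → β p = 0 := by
    intro p hp hpβ
    ext w
    rw [hpβ]
    simp [radialPotential, eulerField_eq_zero hp]
  have hβ0 : β p₀ = 0 := hβfix p₀ hPp₀ hβ'.self_of_nhds.1
  obtain ⟨ξ, hξ, hξ0, hξfix, hξeq⟩ := exists_moserVelocity (h.analytic_left p₀ hp₀)
    (h.analytic_right p₀ hp₀) hβ hS0 hβ0 hDβ e he
  have hequiv := eventually_forall_mem_range_equiv (h.analytic_left p₀ hp₀).continuousAt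
    (h.analytic_right p₀ hp₀).continuousAt hS0 e he
  have hball : ∀ {ρ : ℝ}, 0 < ρ → ∀ᶠ p in 𝓝 p₀, p ∈ Metric.ball p₀ ρ :=
    fun hρ => Metric.ball_mem_nhds p₀ hρ
  obtain ⟨r, hr, hrsub⟩ := Metric.eventually_nhds_iff_ball.1
    ((hball hr₀).and (hequiv.and (hβ'.and hβ.eventually_analyticAt)))
  have hRO : Metric.ball p₀ r ⊆ O := fun p hp => hr₀O (hrsub p hp).1
  let X : ℝ → V → V := fun t p => -(A p + (t : ℂ) • S p).inverse (β p)
  have hX : ∀ t ∈ Ioo (-1 : ℝ) 2, ∀ p ∈ Metric.ball p₀ r, ∀ v,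
      (A p + (t : ℂ) • S p) v + β p = 0 ↔ v = X t p := by
    intro t ht p hp v
    obtain ⟨e', he'⟩ := (hrsub p hp).2.1 t (Ioo_subset_Icc_self ht)
    simp only [X]
    rw [← he', ContinuousLinearMap.inverse_equiv, add_eq_zero_iff_eq_neg]
    change e' v = _ ↔ v = -(e'.symm (β p))
    rw [← map_neg, ContinuousLinearEquiv.eq_symm_apply]
  refine ⟨r, hr, hRO, X, ?_, ?_, ?_⟩
  · intro t ht p hp v
    rw [← hX t ht p hp v, MoserEquation, ContinuousLinearMap.ext_iff]
    refine forall_congr' fun w => ?_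
    rw [← (hrsub p hp).2.2.1.1 w, ← add_eq_zero_iff_eq_neg]
    rfl
  · intro t ht p hp
    obtain ⟨e', he'⟩ := (hrsub p hp).2.1 t (Ioo_subset_Icc_self ht)
    exact exists_lipschitzOnWith_moserField (h.analytic_left p (hRO hp))
      (h.analytic_right p (hRO hp)) (hrsub p hp).2.2.2 e' he'
  · let Γ : V → C(TimeInterval, V) := fun p => curveOfVelocity V (p, ξ p)
    have hΓ : ∀ p, AnalyticAt ℂ ξ p → ContDiffAt ℂ ω Γ p := fun p hp =>
      (curveOfVelocity V).contDiff.contDiffAt.comp (g := curveOfVelocity V) p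
        (contDiffAt_id.prodMk hp.contDiffAt)
    have hΓ0 : Γ p₀ = ContinuousMap.const TimeInterval p₀ := by
      simp only [Γ, hξ0]
      exact curveOfVelocity_zero p₀
    -- `Γ` is continuous for the supremum norm and constant at `p₀`, so nearby trajectories remain
    -- in the ball for the whole time interval.
    have hmem : ∀ᶠ p in 𝓝 p₀, ∀ s, Γ p s ∈ Metric.ball p₀ r := by
      have h1 := (hΓ p₀ hξ).continuousAt.eventually (Metric.ball_mem_nhds (Γ p₀) hr)
      filter_upwards [h1] with p hp s
      refine lt_of_le_of_lt ?_ hp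
      have h2 := ContinuousMap.dist_apply_le_dist (f := Γ p) (g := Γ p₀) s
      rwa [hΓ0] at h2 ⊢
    obtain ⟨N, hN, hNo, hpN⟩ := eventually_nhds_iff.1
      (((hball hr).and hmem).and
        (hξ.eventually_analyticAt.and (hξfix.and hξeq)))
    have hev1 : ∀ (q : V), extendCurve (Γ q) 1 = Γ q ⟨1, by norm_num⟩ := fun q =>
      extendCurve_apply _ _
    have hfd : ∀ p ∈ N, HasFDerivAt (fun q => extendCurve (Γ q) 1)
        (((ContinuousMap.evalCLM ℂ (⟨1, by norm_num⟩ : TimeInterval)).comp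
          (curveOfVelocity V)).comp ((ContinuousLinearMap.id ℂ V).prod (fderiv ℂ ξ p))) p := by
      intro p hp
      simp only [hev1]
      exact HasFDerivAt.comp (g := (ContinuousMap.evalCLM ℂ (⟨1, by norm_num⟩ : TimeInterval)).comp
          (curveOfVelocity V)) p (ContinuousLinearMap.hasFDerivAt _)
        ((hasFDerivAt_id p).prodMk (hN p hp).2.1.differentiableAt.hasFDerivAt)
    refine ⟨N, fun p hp => (hN p hp).1.1, hNo, hpN, fun p => extendCurve (Γ p), ?_⟩
    constructor
    · intro p _
      rw [extendCurve_apply _ (by norm_num), curveOfVelocity_apply, primitive_apply]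
      simp
    · intro p hp t _
      exact (hN p hp).1.2 _
    · intro p hp t ht
      have htI := Ioo_subset_Icc_self ht
      have h1 := (hX t ht _ ((hN p hp).1.2 ⟨t, htI⟩) (ξ p ⟨t, htI⟩)).1 ((hN p hp).2.2.2 ⟨t, htI⟩)
      rw [extendCurve_apply _ htI, ← h1, ← extendCurve_apply (ξ p) htI]
      exact hasDerivAt_curveOfVelocity (p, ξ p) ht
    · intro p hp hPp
      rw [hev1]
      simp only [Γ]
      rw [(hN p hp).2.2.1 (hβfix p hPp (hrsub p (hN p hp).1.1).2.2.1.1), curveOfVelocity_zero]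
      rfl
    · intro p hp
      simp only [hev1]
      exact ((ContinuousMap.evalCLM ℂ (⟨1, by norm_num⟩ : TimeInterval) :
        C(TimeInterval, V) →L[ℂ] V).contDiff.contDiffAt.comp
        (g := (ContinuousMap.evalCLM ℂ (⟨1, by norm_num⟩ : TimeInterval) :
          C(TimeInterval, V) →L[ℂ] V)) p (hΓ p (hN p hp).2.1)).analyticAt
    · intro p hp u w
      rw [(hfd p hp).fderiv]
      have := moser_pullback h.anti_left h.anti_right (R := Metric.ball p₀ r)
        (fun q hq => (h.analytic_left q (hRO hq)).differentiableAt)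
        (fun q hq => (h.analytic_right q (hRO hq)).differentiableAt)
        (fun q hq => (hrsub q hq).2.2.2.differentiableAt)
        (fun q hq => h.closed_left q (hRO hq)) (fun q hq => h.closed_right q (hRO hq))
        (fun q hq => (hrsub q hq).2.2.1.2) (hN p hp).2.1.differentiableAt
        (by filter_upwards [hNo.mem_nhds hp] with q hq using (hN q hq).2.2.2) (hN p hp).1.2 u w
      simp only [extendCurve_apply _ (show (1 : ℝ) ∈ Icc (-1 : ℝ) 2 by norm_num)] at this ⊢
      exact this

end LocalMoser

end HoloDW

namespace HoloDW

open Filter Topology MeasureTheory intervalIntegral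

/-! ### Gluing of local Moser flows -/

section Transition

variable {M V : Type*} [TopologicalSpace M] [TopologicalSpace V] {c d : OpenPartialHomeomorph M V}

lemma transition_mem {p : V} (hp : p ∈ (c.symm ≫ₕ d).source) :
    (c.symm ≫ₕ d) p ∈ (d.symm ≫ₕ c).source := by
  have h1 : p ∈ c.target ∧ c.symm p ∈ d.source := by simpa using hp
  simp [h1]

lemma transition_transition {p : V} (hp : p ∈ (c.symm ≫ₕ d).source) :
    (d.symm ≫ₕ c) ((c.symm ≫ₕ d) p) = p := by
  have h1 : p ∈ c.target ∧ c.symm p ∈ d.source := by simpa using hp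
  simp [h1]

end Transition

section Gluing

variable {V : Type*} [NormedAddCommGroup V] [NormedSpace ℂ V]

/-- A Moser flow near the point `p₀` for the forms `A` and `A + S` on `O`. -/
structure LocalMoserFlow (P : V →L[ℂ] V) (A S : V → V →L[ℂ] V →L[ℂ] ℂ) (O : Set V) (p₀ : V) where
  /-- the region in which the flow takes place -/
  region : Set V
  /-- the set of initial points -/
  domain : Set V
  /-- the time-dependent vector field -/
  field : ℝ → V → V
  /-- the flow -/
  flow : V → ℝ → V
  isOpen_region : IsOpen region
  region_subset : region ⊆ O
  fibreScale_mem : ∀ p ∈ region, ∀ t ∈ Icc (0 : ℝ) 1, fibreScale P t p ∈ region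
  isOpen_domain : IsOpen domain
  domain_subset : domain ⊆ region
  mem_domain : p₀ ∈ domain
  equation_iff : ∀ t ∈ Ioo (-1 : ℝ) 2, ∀ p ∈ region, ∀ v, MoserEquation P A S t p v ↔ v = field t p
  lipschitz : IsLocallyLipschitz field region
  isMoserFlow : IsMoserFlow P A S field region domain flow

theorem nonempty_localMoserFlow [CompleteSpace V] {P : V →L[ℂ] V}
    {A S : V → V →L[ℂ] V →L[ℂ] ℂ} {O : Set V} (h : IsMoserPair P A S O) {p₀ : V} (hp₀ : p₀ ∈ O)
    (hPp₀ : P p₀ = p₀) (e : V ≃L[ℂ] V →L[ℂ] ℂ) (he : (e : V →L[ℂ] V →L[ℂ] ℂ) = A p₀) :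
    Nonempty (LocalMoserFlow P A S O p₀) := by
  obtain ⟨r, _, hrO, X, hX, hL, N, hNr, hN, hpN, Φ, hΦ⟩ := exists_moserFlow h hp₀ hPp₀ e he
  exact ⟨⟨Metric.ball p₀ r, N, X, Φ, Metric.isOpen_ball, hrO,
    fun p hp t ht => fibreScale_mem_ball h.norm_le hPp₀ hp ht, hN, hNr, hpN, hX, hL, hΦ⟩⟩

variable {M : Type*} [TopologicalSpace M] {ι : Type*}

/-- An atlas of charts whose transition maps are complex differentiable, commute with the fibrewise
scalings, and preserve the forms `A i` and `S i`. -/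
structure IsMoserAtlas (P : V →L[ℂ] V) (c : ι → OpenPartialHomeomorph M V)
    (A S : ι → V → V →L[ℂ] V →L[ℂ] ℂ) (O : ι → Set V) : Prop where
  subset_target : ∀ i, O i ⊆ (c i).target
  differentiableAt : ∀ i j, ∀ p ∈ ((c i).symm ≫ₕ c j).source,
    DifferentiableAt ℂ ((c i).symm ≫ₕ c j) p
  scale_mem : ∀ i j, ∀ p ∈ ((c i).symm ≫ₕ c j).source, ∀ z : ℂ,
    fibreScale P z p ∈ ((c i).symm ≫ₕ c j).source
  scale_comm : ∀ i j, ∀ p ∈ ((c i).symm ≫ₕ c j).source, ∀ z : ℂ,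
    ((c i).symm ≫ₕ c j) (fibreScale P z p) = fibreScale P z (((c i).symm ≫ₕ c j) p)
  pullback_left : ∀ i j, ∀ p ∈ ((c i).symm ≫ₕ c j).source, p ∈ O i → ∀ u w,
    A j (((c i).symm ≫ₕ c j) p) (fderiv ℂ ((c i).symm ≫ₕ c j) p u)
      (fderiv ℂ ((c i).symm ≫ₕ c j) p w) = A i p u w
  pullback_right : ∀ i j, ∀ p ∈ ((c i).symm ≫ₕ c j).source, p ∈ O i → ∀ u w,
    S j (((c i).symm ≫ₕ c j) p) (fderiv ℂ ((c i).symm ≫ₕ c j) p u)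
      (fderiv ℂ ((c i).symm ≫ₕ c j) p w) = S i p u w

namespace IsMoserAtlas

variable {P : V →L[ℂ] V} {c : ι → OpenPartialHomeomorph M V}
  {A S : ι → V → V →L[ℂ] V →L[ℂ] ℂ} {O : ι → Set V}

/-- Comes from differentiating `scale_comm` with respect to the point. -/
lemma fderiv_fibreScale (h : IsMoserAtlas P c A S O) {i j : ι} {p : V}
    (hp : p ∈ ((c i).symm ≫ₕ c j).source) (z : ℂ) (w : V) :
    fderiv ℂ ((c i).symm ≫ₕ c j) (fibreScale P z p) (fibreScale P z w) =
      fibreScale P z (fderiv ℂ ((c i).symm ≫ₕ c j) p w) := by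
  set H := (c i).symm ≫ₕ c j
  have h1 : HasFDerivAt (fun q => H (fibreScale P z q)) _ p :=
    (h.differentiableAt i j _ (h.scale_mem i j p hp z)).hasFDerivAt.comp p
      (fibreScale P z).hasFDerivAt
  have h2 : HasFDerivAt (fun q => fibreScale P z (H q)) _ p :=
    (fibreScale P z).hasFDerivAt.comp p (h.differentiableAt i j p hp).hasFDerivAt
  have h3 := h1.congr_of_eventuallyEq (f₁ := fun q => fibreScale P z (H q)) (by
    filter_upwards [H.open_source.mem_nhds hp] with q hq using (h.scale_comm i j q hq z).symm)
  exact congrArg (fun L => L w) (h3.unique h2)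

/-- Comes from differentiating `scale_comm` with respect to the scaling parameter. -/
lemma fderiv_eulerField (h : IsMoserAtlas P c A S O) {i j : ι} {p : V}
    (hp : p ∈ ((c i).symm ≫ₕ c j).source) (z : ℂ) :
    fderiv ℂ ((c i).symm ≫ₕ c j) (fibreScale P z p) (eulerField P p) =
      eulerField P (((c i).symm ≫ₕ c j) p) := by
  set H := (c i).symm ≫ₕ c j
  have h1 : HasDerivAt (fun z => H (fibreScale P z p)) _ z :=
    (h.differentiableAt i j _ (h.scale_mem i j p hp z)).hasFDerivAt.comp_hasDerivAt z
      (hasDerivAt_fibreScale P p z)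
  have h2 := h1.congr_of_eventuallyEq (f₁ := fun z => fibreScale P z (H p))
    (Eventually.of_forall fun z => (h.scale_comm i j p hp z).symm)
  exact h2.unique (hasDerivAt_fibreScale P (H p) z)

/-- Naturality of the potential: its formula involves only the scalings, the Euler field and `S`,
all respected by transition maps. The whole segment of scaled points must lie in `O i`, as `S` is
compared only there. -/
lemma radialPotential_comp (h : IsMoserAtlas P c A S O) {i j : ι} {p : V}
    (hp : p ∈ ((c i).symm ≫ₕ c j).source)
    (hO : ∀ t ∈ Icc (0 : ℝ) 1, fibreScale P t p ∈ O i) (w : V) :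
    radialPotential P (S j) (((c i).symm ≫ₕ c j) p) (fderiv ℂ ((c i).symm ≫ₕ c j) p w) =
      radialPotential P (S i) p w := by
  refine integral_congr fun t ht => ?_
  rw [uIcc_of_le zero_le_one] at ht
  change S j (fibreScale P t _) _ (fibreScale P t _) = S i _ _ _
  rw [← h.pullback_right i j _ (h.scale_mem i j p hp t) (hO t ht), h.fderiv_eulerField hp,
    h.fderiv_fibreScale hp, h.scale_comm i j p hp]

lemma fderiv_symm (h : IsMoserAtlas P c A S O) {i j : ι} {p : V}
    (hp : p ∈ ((c i).symm ≫ₕ c j).source) (w : V) :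
    fderiv ℂ ((c i).symm ≫ₕ c j) p (fderiv ℂ ((c j).symm ≫ₕ c i) (((c i).symm ≫ₕ c j) p) w) = w := by
  set H := (c i).symm ≫ₕ c j
  set H' := (c j).symm ≫ₕ c i
  have hd : HasFDerivAt H (fderiv ℂ H p) (H' (H p)) := by
    rw [transition_transition hp]
    exact (h.differentiableAt i j p hp).hasFDerivAt
  have h1 : HasFDerivAt (fun q => H (H' q)) _ (H p) :=
    hd.comp (H p) (h.differentiableAt j i _ (transition_mem hp)).hasFDerivAt
  have h2 := h1.congr_of_eventuallyEq (f₁ := fun q => q) (by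
    filter_upwards [H'.open_source.mem_nhds (transition_mem hp)] with q hq using (transition_transition hq).symm)
  exact (congrArg (fun L => L w) (h2.unique (hasFDerivAt_id _)))

lemma moserEquation_comp (h : IsMoserAtlas P c A S O) {i j : ι} {p : V}
    (hp : p ∈ ((c i).symm ≫ₕ c j).source) (hpO : p ∈ O i)
    (hO : ∀ t ∈ Icc (0 : ℝ) 1, fibreScale P t p ∈ O i) {t : ℝ} {v : V}
    (hv : MoserEquation P (A i) (S i) t p v) :
    MoserEquation P (A j) (S j) t (((c i).symm ≫ₕ c j) p) (fderiv ℂ ((c i).symm ≫ₕ c j) p v) := by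
  intro w
  rw [← h.fderiv_symm hp w, h.radialPotential_comp hp hO, h.pullback_left i j p hp hpO,
    h.pullback_right i j p hp hpO]
  exact hv _

variable {z : ι → V} (D : ∀ i, LocalMoserFlow P (A i) (S i) (O i) (z i))

/-- Moser's equation is invariant under transition maps and has exactly one solution in the region
of chart `j`, namely the field there. -/
lemma field_comp (h : IsMoserAtlas P c A S O) {i j : ι} {p : V}
    (hp : p ∈ ((c i).symm ≫ₕ c j).source) (hpi : p ∈ (D i).region)
    (hpj : ((c i).symm ≫ₕ c j) p ∈ (D j).region) {t : ℝ} (ht : t ∈ Ioo (-1 : ℝ) 2) :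
    fderiv ℂ ((c i).symm ≫ₕ c j) p ((D i).field t p) =
      (D j).field t (((c i).symm ≫ₕ c j) p) := by
  rw [← (D j).equation_iff t ht _ hpj]
  exact h.moserEquation_comp hp ((D i).region_subset hpi)
    (fun s hs => (D i).region_subset ((D i).fibreScale_mem p hpi s hs))
    (((D i).equation_iff t ht p hpi _).2 rfl)

/-- An integral curve of the field in one of the charts. -/
def IsIntegralCurveIn (i : ι) (γ : ℝ → V) : Prop :=
  ∀ t ∈ Ioo (-1 : ℝ) 2, γ t ∈ (D i).region ∧ HasDerivAt γ ((D i).field t (γ t)) t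

/-- The transition map carries `δ` near `t₀` to an integral curve of the field in chart `i`, by
`field_comp`; there the local Lipschitz condition gives uniqueness. -/
lemma eventuallyEq_of_isIntegralCurveIn (h : IsMoserAtlas P c A S O) {i j : ι} {γ δ : ℝ → V}
    (hγ : IsIntegralCurveIn D i γ) (hδ : IsIntegralCurveIn D j δ) {t₀ : ℝ}
    (ht₀ : t₀ ∈ Ioo (-1 : ℝ) 2) (h₀ : (c i).symm (γ t₀) = (c j).symm (δ t₀)) :
    ∀ᶠ t in 𝓝 t₀, (c i).symm (γ t) = (c j).symm (δ t) := by
  set H := (c j).symm ≫ₕ c i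
  have hmemj : ∀ t ∈ Ioo (-1 : ℝ) 2, δ t ∈ (c j).target :=
    fun t ht => h.subset_target j ((D j).region_subset (hδ t ht).1)
  have hγ₀ : γ t₀ ∈ (c i).target := h.subset_target i ((D i).region_subset (hγ t₀ ht₀).1)
  have hδ₀ : δ t₀ ∈ H.source := by
    have : (c j).symm (δ t₀) ∈ (c i).source := by rw [← h₀]; exact (c i).map_target hγ₀
    simpa [H] using ⟨hmemj t₀ ht₀, this⟩
  have hH₀ : H (δ t₀) = γ t₀ := by
    change c i ((c j).symm (δ t₀)) = _
    rw [← h₀, (c i).right_inv hγ₀]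
  have hcont : ContinuousAt (fun t => H (δ t)) t₀ :=
    (H.continuousAt hδ₀).comp (hδ t₀ ht₀).2.continuousAt
  have hIoo : ∀ᶠ t in 𝓝 t₀, t ∈ Ioo (-1 : ℝ) 2 := Ioo_mem_nhds ht₀.1 ht₀.2
  have hsrc : ∀ᶠ t in 𝓝 t₀, δ t ∈ H.source :=
    (hδ t₀ ht₀).2.continuousAt.eventually (H.open_source.mem_nhds hδ₀)
  obtain ⟨K, s, hs, hK⟩ := (D i).lipschitz t₀ ht₀ (γ t₀) (hγ t₀ ht₀).1
  have hR : ∀ᶠ t in 𝓝 t₀, H (δ t) ∈ (D i).region := by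
    refine hcont.eventually ((D i).isOpen_region.mem_nhds ?_)
    simpa only [hH₀] using (hγ t₀ ht₀).1
  have hs' : ∀ᶠ t in 𝓝 t₀, H (δ t) ∈ s := by
    refine hcont.eventually ?_
    simp only [hH₀]
    exact hs
  have huniq : γ =ᶠ[𝓝 t₀] fun t => H (δ t) := by
    refine ODE_solution_unique_of_eventually (v := (D i).field) (s := fun _ => s) (K := K) hK
      ?_ ?_ hH₀.symm
    · filter_upwards [hIoo, (hγ t₀ ht₀).2.continuousAt.eventually hs] with t ht hts
      exact ⟨(hγ t ht).2, hts⟩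
    · filter_upwards [hIoo, hsrc, hR, hs'] with t ht htsrc htR hts
      refine ⟨?_, hts⟩
      rw [← h.field_comp D htsrc (hδ t ht).1 htR ht]
      exact hasDerivAt_comp_curve (h.differentiableAt j i _ htsrc).hasFDerivAt (hδ t ht).2
  filter_upwards [huniq, hsrc] with t ht htsrc
  have h1 : δ t ∈ (c j).target ∧ (c j).symm (δ t) ∈ (c i).source := by simpa [H] using htsrc
  rw [ht]
  exact (c i).left_inv h1.2

/-- Integral curves in different charts that meet at some time agree at all times. -/
theorem eq_of_isIntegralCurveIn [T2Space M] (h : IsMoserAtlas P c A S O) {i j : ι} {γ δ : ℝ → V}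
    (hγ : IsIntegralCurveIn D i γ) (hδ : IsIntegralCurveIn D j δ) {t₀ : ℝ}
    (ht₀ : t₀ ∈ Ioo (-1 : ℝ) 2) (h₀ : (c i).symm (γ t₀) = (c j).symm (δ t₀)) {t : ℝ}
    (ht : t ∈ Ioo (-1 : ℝ) 2) : (c i).symm (γ t) = (c j).symm (δ t) := by
  have hcont : ∀ {i : ι} {γ : ℝ → V}, IsIntegralCurveIn D i γ → ∀ s ∈ Ioo (-1 : ℝ) 2,
      ContinuousAt (fun s => (c i).symm (γ s)) s := fun {i γ} hγ s hs =>
    ((c i).symm.continuousAt (h.subset_target i ((D i).region_subset (hγ s hs).1))).comp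
      (hγ s hs).2.continuousAt
  -- The set of agreement is open by local uniqueness and relatively closed because `M` is
  -- Hausdorff, so it is all of the connected interval.
  let u : Set ℝ := {s | s ∈ Ioo (-1 : ℝ) 2 ∧ (c i).symm (γ s) = (c j).symm (δ s)}
  have hu : IsOpen u := by
    rw [isOpen_iff_mem_nhds]
    rintro s ⟨hs, hs'⟩
    filter_upwards [Ioo_mem_nhds hs.1 hs.2, h.eventuallyEq_of_isIntegralCurveIn D hγ hδ hs hs']
      with r hr hr' using ⟨hr, hr'⟩
  have hsub : Ioo (-1 : ℝ) 2 ⊆ u := by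
    refine isPreconnected_Ioo.subset_of_closure_inter_subset hu ⟨t₀, ht₀, ht₀, h₀⟩ ?_
    rintro s ⟨hs, hs'⟩
    refine ⟨hs', tendsto_nhds_unique_of_frequently_eq (hcont hγ s hs') (hcont hδ s hs') ?_⟩
    exact (mem_closure_iff_frequently.1 hs).mono fun r hr => hr.2
  exact (hsub ht).2

end IsMoserAtlas

end Gluing

end HoloDW

namespace HoloDW

open Filter Topology

/-! ### The glued time-one map and its inverse -/

section TimeOneMap

variable {V : Type*} [NormedAddCommGroup V] [NormedSpace ℂ V]
  {M : Type*} [TopologicalSpace M] {ι : Type*}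

/-- A map that is locally injective-open on an open set gives an open partial homeomorphism. -/
lemma exists_openPartialHomeomorph_of_injOn {X : Type*} [TopologicalSpace X] [Nonempty X]
    {f : X → X} {U : Set X} (hU : IsOpen U) (hinj : InjOn f U)
    (hf : ∀ p ∈ U, map f (𝓝 p) = 𝓝 (f p)) :
    ∃ F : OpenPartialHomeomorph X X, F.source = U ∧ ∀ p, F p = f p := by
  have ho : IsOpenMap (U.domRestrict f) := by
    refine IsOpenMap.of_nhds_le ?_
    rintro ⟨p, hp⟩
    change 𝓝 (f p) ≤ map (f ∘ Subtype.val) (𝓝 (⟨p, hp⟩ : U))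
    rw [← map_map, map_nhds_subtype_coe_eq_nhds hp (hU.mem_nhds hp)]
    exact (hf p hp).ge
  exact ⟨OpenPartialHomeomorph.ofContinuousOpenRestrict (hinj.toPartialEquiv f U)
    (fun p hp => ContinuousAt.continuousWithinAt (hf p hp).le) ho hU, rfl, fun _ => rfl⟩

namespace IsMoserAtlas

variable {P : V →L[ℂ] V} {c : ι → OpenPartialHomeomorph M V}
  {A S : ι → V → V →L[ℂ] V →L[ℂ] ℂ} {O : ι → Set V}
  {z : ι → V} (D : ∀ i, LocalMoserFlow P (A i) (S i) (O i) (z i))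

lemma isIntegralCurveIn_flow {i : ι} {p : V} (hp : p ∈ (D i).domain) :
    IsIntegralCurveIn D i ((D i).flow p) := fun t ht =>
  ⟨(D i).isMoserFlow.mem p hp t ht, (D i).isMoserFlow.deriv p hp t ht⟩

variable [FiniteDimensional ℂ V]

/-- The time-one map of a Moser flow has invertible derivative. -/
lemma exists_equiv_fderiv_flow {i : ι}
    (hnd : ∀ p ∈ O i, ∀ u, (∀ w, A i p u w = 0) → u = 0) {p : V} (hp : p ∈ (D i).domain) :
    ∃ e : V ≃L[ℂ] V, (e : V →L[ℂ] V) = fderiv ℂ (fun q => (D i).flow q 1) p := by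
  have hinj : Function.Injective (fderiv ℂ (fun q => (D i).flow q 1) p : V →ₗ[ℂ] V) := by
    rw [injective_iff_map_eq_zero]
    intro u hu
    refine hnd p ((D i).region_subset ((D i).domain_subset hp)) u fun w => ?_
    rw [← (D i).isMoserFlow.pullback p hp u w]
    have : fderiv ℂ (fun q => (D i).flow q 1) p u = 0 := hu
    rw [this]
    simp
  refine ⟨(LinearEquiv.ofInjectiveEndo _ hinj).toContinuousLinearEquiv, ?_⟩
  ext
  rfl

/-- The time-one maps of the local Moser flows glue to a homeomorphism between open sets, whose
inverse is analytic in the given charts. -/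
theorem exists_timeOneMap [T2Space M] (h : IsMoserAtlas P c A S O)
    (hnd : ∀ i, ∀ p ∈ O i, ∀ u, (∀ w, A i p u w = 0) → u = 0) :
    ∃ f : OpenPartialHomeomorph M M,
      (∀ p, p ∈ f.source ↔ ∃ i, p ∈ (c i).source ∧ c i p ∈ (D i).domain) ∧
      ∀ i, ∀ p ∈ (c i).source, c i p ∈ (D i).domain →
        (D i).flow (c i p) 1 ∈ (c i).target ∧ f p = (c i).symm ((D i).flow (c i p) 1) ∧
        ∃ g : V → V, ContDiffAt ℂ ω g (c i (f p)) ∧ g (c i (f p)) = c i p ∧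
          ∀ᶠ q in 𝓝 (f p), f.symm q = (c i).symm (g (c i q)) := by
  classical
  have h1 : (1 : ℝ) ∈ Ioo (-1 : ℝ) 2 := by norm_num
  have h0 : (0 : ℝ) ∈ Ioo (-1 : ℝ) 2 := by norm_num
  rcases isEmpty_or_nonempty M with hM | hM
  · exact ⟨OpenPartialHomeomorph.refl M, fun p => (hM.false p).elim, fun i p => (hM.false p).elim⟩
  let U : Set M := {p | ∃ i, p ∈ (c i).source ∧ c i p ∈ (D i).domain}
  -- The chart is chosen arbitrarily; `hf` shows independence of the choice, because trajectories
  -- with the same initial point agree at time `1`.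
  let f : M → M := fun p => if hp : p ∈ U then (c hp.choose).symm
    ((D hp.choose).flow (c hp.choose p) 1) else p
  have hf : ∀ i, ∀ p ∈ (c i).source, c i p ∈ (D i).domain →
      f p = (c i).symm ((D i).flow (c i p) 1) := by
    intro i p hp hpi
    have hpU : p ∈ U := ⟨i, hp, hpi⟩
    have hs := hpU.choose_spec
    simp only [f, dif_pos hpU]
    refine h.eq_of_isIntegralCurveIn D (isIntegralCurveIn_flow D hs.2)
      (isIntegralCurveIn_flow D hpi) h0 ?_ h1
    rw [(D _).isMoserFlow.initial _ hs.2, (D _).isMoserFlow.initial _ hpi,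
      (c _).left_inv hs.1, (c _).left_inv hp]
  have htgt : ∀ i, ∀ p ∈ (D i).domain, (D i).flow p 1 ∈ (c i).target := fun i p hp =>
    h.subset_target i ((D i).region_subset ((D i).isMoserFlow.mem p hp 1 h1))
  have hWopen : ∀ i, IsOpen ((c i).source ∩ c i ⁻¹' (D i).domain) := fun i =>
    (c i).isOpen_inter_preimage (D i).isOpen_domain
  have hU : IsOpen U := by
    have : U = ⋃ i, (c i).source ∩ c i ⁻¹' (D i).domain := by
      ext p
      simp [U]
    rw [this]
    exact isOpen_iUnion hWopen
  -- The same uniqueness run backwards: trajectories that meet at time `1` agree at time `0`.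
  have hinj : InjOn f U := by
    rintro p ⟨i, hp, hpi⟩ q ⟨j, hq, hqj⟩ hpq
    rw [hf i p hp hpi, hf j q hq hqj] at hpq
    have := h.eq_of_isIntegralCurveIn D (isIntegralCurveIn_flow D hpi)
      (isIntegralCurveIn_flow D hqj) h1 hpq h0
    rwa [(D _).isMoserFlow.initial _ hpi, (D _).isMoserFlow.initial _ hqj,
      (c _).left_inv hp, (c _).left_inv hq] at this
  have hnhds : ∀ p ∈ U, map f (𝓝 p) = 𝓝 (f p) := by
    rintro p ⟨i, hp, hpi⟩
    have hev : f =ᶠ[𝓝 p] (c i).symm ∘ (fun q => (D i).flow q 1) ∘ c i := by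
      filter_upwards [(hWopen i).mem_nhds ⟨hp, hpi⟩] with q hq using hf i q hq.1 hq.2
    obtain ⟨e, he⟩ := exists_equiv_fderiv_flow D (hnd i) hpi
    have hst : HasStrictFDerivAt (fun q => (D i).flow q 1) (e : V →L[ℂ] V) (c i p) := by
      rw [he]
      exact ((D i).isMoserFlow.analytic _ hpi).hasStrictFDerivAt
    rw [Filter.map_congr hev, ← map_map, ← map_map, (c i).map_nhds_eq hp,
      hst.map_nhds_eq_of_equiv, (c i).symm.map_nhds_eq (htgt i _ hpi), hf i p hp hpi]
  obtain ⟨F, hFU, hFf⟩ := exists_openPartialHomeomorph_of_injOn hU hinj hnhds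
  refine ⟨F, fun p => by rw [hFU]; rfl, fun i p hp hpi => ⟨htgt i _ hpi, ?_, ?_⟩⟩
  · rw [hFf, hf i p hp hpi]
  · have hFp : F p = (c i).symm ((D i).flow (c i p) 1) := by rw [hFf, hf i p hp hpi]
    -- In the chart, `F` is the local time-one map, analytic with invertible derivative, so `H.symm`
    -- is analytic at the image point and serves as `g`.
    let H : OpenPartialHomeomorph V V := ((c i).symm ≫ₕ F) ≫ₕ c i
    have hpF : p ∈ F.source := by rw [hFU]; exact ⟨i, hp, hpi⟩
    have hFps : F p ∈ (c i).source := by rw [hFp]; exact (c i).map_target (htgt i _ hpi)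
    have hH0 : c i p ∈ H.source := by
      simp [H, hp, hpF, hFps]
    have hHp : H (c i p) = c i (F p) := by
      simp [H, hp]
    have hHev : H =ᶠ[𝓝 (c i p)] fun q => (D i).flow q 1 := by
      have hd : ∀ᶠ q in 𝓝 (c i p), q ∈ (D i).domain := (D i).isOpen_domain.mem_nhds hpi
      filter_upwards [H.open_source.mem_nhds hH0, hd,
        (c i).open_target.mem_nhds ((c i).map_source hp)] with q _ hqd hqt
      change c i (F ((c i).symm q)) = _
      rw [hFf, hf i _ ((c i).map_target hqt) (by rwa [(c i).right_inv hqt]), (c i).right_inv hqt,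
        (c i).right_inv (htgt i q hqd)]
    have hHt : c i (F p) ∈ H.target := by rw [← hHp]; exact H.map_source hH0
    have hHs : H.symm (c i (F p)) = c i p := by rw [← hHp, H.left_inv hH0]
    obtain ⟨e, he⟩ := exists_equiv_fderiv_flow D (hnd i) hpi
    have han := (D i).isMoserFlow.analytic _ hpi
    refine ⟨H.symm, H.contDiffAt_symm (f₀' := e) hHt ?_ ?_, hHs, ?_⟩
    · rw [hHs, he]
      exact han.differentiableAt.hasFDerivAt.congr_of_eventuallyEq hHev
    · rw [hHs]
      exact han.contDiffAt.congr_of_eventuallyEq hHev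
    · have hsymm : ContinuousAt F.symm (F p) := F.symm.continuousAt (F.map_source hpF)
      have hsrc : ∀ᶠ q in 𝓝 (F p), F.symm q ∈ (c i).source :=
        hsymm.eventually ((c i).open_source.mem_nhds (by rwa [F.left_inv hpF]))
      filter_upwards [(c i).open_source.mem_nhds hFps, hsrc] with q hq hqs
      change _ = (c i).symm (c i (F.symm ((c i).symm (c i q))))
      rw [(c i).left_inv hq, (c i).left_inv hqs]

end IsMoserAtlas

end TimeOneMap

end HoloDW

namespace HoloDW

open Filter Topology

/-! ### Two-forms on manifolds -/

section TwoForms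

variable {V : Type*} [NormedAddCommGroup V] [NormedSpace ℂ V]
  {H : Type*} [TopologicalSpace H] {I : ModelWithCorners ℂ V H}
  {M : Type*} [TopologicalSpace M] [ChartedSpace H M]
  {V' : Type*} [NormedAddCommGroup V'] [NormedSpace ℂ V']
  {H' : Type*} [TopologicalSpace H'] {J : ModelWithCorners ℂ V' H'}
  {N : Type*} [TopologicalSpace N] [ChartedSpace H' N]
  {V'' : Type*} [NormedAddCommGroup V''] [NormedSpace ℂ V'']
  {H'' : Type*} [TopologicalSpace H''] {J' : ModelWithCorners ℂ V'' H''}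
  {N' : Type*} [TopologicalSpace N'] [ChartedSpace H'' N']

/-- The pullback of a two-form along a map between different manifolds. -/
def TwoForm.pullbackTo (J : ModelWithCorners ℂ V' H') (σ : TwoForm I M) (f : N → M) : TwoForm J N :=
  fun y => (σ (f y)).compContinuousLinearMap (mfderiv J I f y)

lemma TwoForm.pullbackTo_congr (σ : TwoForm I M) {f g : N → M} {y : N} (h : f =ᶠ[𝓝 y] g) :
    σ.pullbackTo J f y = σ.pullbackTo J g y := by
  have h1 : f y = g y := h.self_of_nhds
  have h2 : (mfderiv J I f y : V' →L[ℂ] V) = mfderiv J I g y := h.mfderiv_eq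
  let σ' : M → V [⋀^Fin 2]→L[ℂ] ℂ := σ
  change (σ' (f y)).compContinuousLinearMap (mfderiv J I f y : V' →L[ℂ] V) =
    (σ' (g y)).compContinuousLinearMap (mfderiv J I g y : V' →L[ℂ] V)
  rw [h1, h2]

lemma TwoForm.pullbackTo_comp (σ : TwoForm I M) {f : N → M} {g : N' → N} {y : N'}
    (hf : MDifferentiableAt J I f (g y)) (hg : MDifferentiableAt J' J g y) :
    σ.pullbackTo J' (f ∘ g) y =
      (σ.pullbackTo J f (g y)).compContinuousLinearMap (mfderiv J' J g y) := by
  have h : mfderiv J' I (f ∘ g) y = (mfderiv J I f (g y)).comp (mfderiv J' J g y) :=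
    mfderiv_comp y hf hg
  unfold TwoForm.pullbackTo
  rw [h]
  rfl

lemma TwoForm.pullbackTo_id (σ : TwoForm I M) (p : M) : σ.pullbackTo I id p = σ p := by
  unfold TwoForm.pullbackTo
  rw [mfderiv_id]
  ext v
  rfl

/-- An alternating 2-form as a bilinear map. -/
def toBilinear (V : Type*) [NormedAddCommGroup V] [NormedSpace ℂ V] :
    (V [⋀^Fin 2]→L[ℂ] ℂ) →L[ℂ] V →L[ℂ] V →L[ℂ] ℂ :=
  LinearMap.mkContinuous₂
    { toFun := fun φ =>
        { toFun := fun u =>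
            (ContinuousAlternatingMap.ofSubsingletonLIE (𝕜 := ℂ) (E := V) (F := ℂ) (0 : Fin 1)).symm
              (φ.curryLeft u)
          map_add' := by intro u v; ext w; simp
          map_smul' := by intro c u; ext w; simp }
      map_add' := by intro φ ψ; ext u w; simp
      map_smul' := by intro c φ; ext u w; simp }
    1 (by
      intro φ u
      simp only [LinearMap.coe_mk, AddHom.coe_mk, LinearIsometryEquiv.norm_map]
      rw [one_mul, ← φ.norm_curryLeft]
      exact φ.curryLeft.le_opNorm u)

lemma toBilinear_apply (φ : V [⋀^Fin 2]→L[ℂ] ℂ) (u w : V) : toBilinear V φ u w = φ ![u, w] := by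
  change φ (Matrix.vecCons u fun _ => w) = _
  congr 1
  ext i
  fin_cases i <;> rfl

lemma toBilinear_anti (φ : V [⋀^Fin 2]→L[ℂ] ℂ) (u w : V) :
    toBilinear V φ u w = - toBilinear V φ w u := by
  rw [toBilinear_apply, toBilinear_apply]
  have h : φ (![w, u] ∘ Equiv.swap 0 1) = - φ ![w, u] :=
    φ.toAlternatingMap.map_swap _ (by decide)
  rw [← h]
  congr 1
  ext i
  fin_cases i <;> rfl

lemma toBilinear_compContinuousLinearMap (φ : V [⋀^Fin 2]→L[ℂ] ℂ) (L : V' →L[ℂ] V) (u w : V') :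
    toBilinear V' (φ.compContinuousLinearMap L) u w = toBilinear V φ (L u) (L w) := by
  rw [toBilinear_apply, toBilinear_apply]
  change φ (L ∘ ![u, w]) = _
  congr 1
  ext i
  fin_cases i <;> rfl

lemma isClosedAt_toBilinear {σ : V → V [⋀^Fin 2]→L[ℂ] ℂ} {p : V} (hσ : DifferentiableAt ℂ σ p)
    (h : extDeriv σ p = 0) : IsClosedAt (fun q => toBilinear V (σ q)) p := by
  intro a b c
  have hT : HasFDerivAt (toBilinear V) (toBilinear V) (σ p) := by
    apply ContinuousLinearMap.hasFDerivAt
  have hd : fderiv ℂ (fun q => toBilinear V (σ q)) p = (toBilinear V).comp (fderiv ℂ σ p) :=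
    (hT.comp (g := toBilinear V) p hσ.hasFDerivAt).fderiv
  have h1 : ∑ i : Fin 3, (-1 : ℤ) ^ (i : ℕ) •
      fderiv ℂ σ p (![a, b, c] i) (i.removeNth ![a, b, c]) = 0 := by
    rw [← ContinuousAlternatingMap.alternatizeUncurryFin_apply]
    exact congrArg (fun φ => φ ![a, b, c]) h
  rw [Fin.sum_univ_three] at h1
  rw [hd]
  simp only [ContinuousLinearMap.comp_apply, toBilinear_apply]
  have e0 : (0 : Fin 3).removeNth ![a, b, c] = ![b, c] := by
    ext i; fin_cases i <;> rfl
  have e1 : (1 : Fin 3).removeNth ![a, b, c] = ![a, c] := by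
    ext i; fin_cases i <;> rfl
  have e2 : (2 : Fin 3).removeNth ![a, b, c] = ![a, b] := by
    ext i; fin_cases i <;> rfl
  rw [e0, e1, e2] at h1
  simp at h1
  linear_combination h1

/-- A non-degenerate bilinear form identifies a finite-dimensional space with its dual. -/
lemma exists_equiv_dual [FiniteDimensional ℂ V] {L : V →L[ℂ] V →L[ℂ] ℂ}
    (hL : ∀ u, (∀ w, L u w = 0) → u = 0) :
    ∃ e : V ≃L[ℂ] V →L[ℂ] ℂ, (e : V →L[ℂ] V →L[ℂ] ℂ) = L := by
  have hinj : Function.Injective (L : V →ₗ[ℂ] V →L[ℂ] ℂ) := by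
    rw [injective_iff_map_eq_zero]
    intro u hu
    refine hL u fun w => ?_
    have : L u = 0 := hu
    rw [this]
    rfl
  have hdim : Module.finrank ℂ V = Module.finrank ℂ (V →L[ℂ] ℂ) := by
    rw [← (LinearMap.toContinuousLinearMap : (V →ₗ[ℂ] ℂ) ≃ₗ[ℂ] V →L[ℂ] ℂ).finrank_eq]
    exact (Subspace.dual_finrank_eq (K := ℂ) (V := V)).symm
  have : FiniteDimensional ℂ (V →L[ℂ] ℂ) :=
    (LinearMap.toContinuousLinearMap : (V →ₗ[ℂ] ℂ) ≃ₗ[ℂ] V →L[ℂ] ℂ).finiteDimensional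
  refine ⟨(LinearMap.linearEquivOfInjective (L : V →ₗ[ℂ] V →L[ℂ] ℂ) hinj
    hdim).toContinuousLinearEquiv, ?_⟩
  ext
  rfl

variable [I.Boundaryless]

/-- The preferred chart at `x`, with values in the model vector space. -/
def vectorChart (I : ModelWithCorners ℂ V H) [I.Boundaryless] (x : M) :
    OpenPartialHomeomorph M V where
  toPartialEquiv := extChartAt I x
  open_source := isOpen_extChartAt_source x
  open_target := isOpen_extChartAt_target x
  continuousOn_toFun := continuousOn_extChartAt x
  continuousOn_invFun := continuousOn_extChartAt_symm x

lemma isOpen_chartDomain {U : Set M} (hU : IsOpen U) (x : M) : IsOpen (chartDomain I U x) :=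
  (vectorChart I x).symm.isOpen_inter_preimage hU

lemma analyticAt_inChart {σ : TwoForm I M} {U : Set M} (hU : IsOpen U)
    (hσ : IsComplexSymplecticOn σ U) {x : M} {y : V} (hy : y ∈ chartDomain I U x) :
    ContDiffAt ℂ ω (σ.inChart x) y :=
  (hσ.holomorphic x).contDiffAt ((isOpen_chartDomain hU x).mem_nhds hy)

variable [IsManifold I ω M]

lemma contMDiffAt_vectorChart {x p : M} (hp : p ∈ (vectorChart I x).source) :
    ContMDiffAt I 𝓘(ℂ, V) ω (vectorChart I x) p :=
  contMDiffAt_extChartAt' (by rwa [← extChartAt_source I])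

lemma contMDiffAt_vectorChart_symm {x : M} {y : V} (hy : y ∈ (vectorChart I x).target) :
    ContMDiffAt 𝓘(ℂ, V) I ω (vectorChart I x).symm y :=
  (contMDiffOn_extChartAt_symm x).contMDiffAt ((isOpen_extChartAt_target x).mem_nhds hy)

lemma mdifferentiableAt_vectorChart {x p : M} (hp : p ∈ (vectorChart I x).source) :
    MDifferentiableAt I 𝓘(ℂ, V) (vectorChart I x) p :=
  (contMDiffAt_vectorChart hp).mdifferentiableAt (by simp)

lemma mdifferentiableAt_vectorChart_symm {x : M} {y : V} (hy : y ∈ (vectorChart I x).target) :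
    MDifferentiableAt 𝓘(ℂ, V) I (vectorChart I x).symm y :=
  (contMDiffAt_vectorChart_symm hy).mdifferentiableAt (by simp)

/-- A two-form is recovered from its expression in a chart. -/
lemma inChart_compContinuousLinearMap (σ : TwoForm I M) {x p : M}
    (hp : p ∈ (vectorChart I x).source) :
    ContinuousAlternatingMap.compContinuousLinearMap (σ.inChart x (vectorChart I x p))
      (mfderiv I 𝓘(ℂ, V) (vectorChart I x) p) = σ p := by
  refine (TwoForm.pullbackTo_comp σ (J := 𝓘(ℂ, V)) (f := (vectorChart I x).symm)
    (mdifferentiableAt_vectorChart_symm ((vectorChart I x).map_source hp))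
    (mdifferentiableAt_vectorChart hp)).symm.trans
    ((TwoForm.pullbackTo_congr σ ?_).trans (TwoForm.pullbackTo_id σ p))
  filter_upwards [(vectorChart I x).open_source.mem_nhds hp] with q hq
  exact (vectorChart I x).left_inv hq

lemma mfderiv_vectorChart_comp_symm {x : M} {y : V} (hy : y ∈ (vectorChart I x).target) (v : V) :
    mfderiv I 𝓘(ℂ, V) (vectorChart I x) ((vectorChart I x).symm y)
      (mfderiv 𝓘(ℂ, V) I (vectorChart I x).symm y v) = v := by
  have h := mfderiv_comp y (mdifferentiableAt_vectorChart ((vectorChart I x).map_target hy))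
    (mdifferentiableAt_vectorChart_symm hy)
  have h2 : (vectorChart I x) ∘ (vectorChart I x).symm =ᶠ[𝓝 y] id := by
    filter_upwards [(vectorChart I x).open_target.mem_nhds hy] with q hq
    exact (vectorChart I x).right_inv hq
  have h3 := h2.mfderiv_eq (I := 𝓘(ℂ, V)) (I' := 𝓘(ℂ, V))
  rw [h, mfderiv_id] at h3
  exact congrArg (fun L => L v) h3

lemma inChart_nondegenerate {σ : TwoForm I M} {U : Set M} (hσ : IsComplexSymplecticOn σ U) {x : M}
    {y : V} (hy : y ∈ chartDomain I U x) {u : V}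
    (hu : ∀ w, toBilinear V (σ.inChart x y) u w = 0) : u = 0 := by
  have hyt : y ∈ (vectorChart I x).target := hy.1
  have h1 : mfderiv 𝓘(ℂ, V) I (vectorChart I x).symm y u = 0 := by
    refine hσ.nondegenerate ((vectorChart I x).symm y) hy.2 _ fun w => ?_
    rw [← inChart_compContinuousLinearMap σ ((vectorChart I x).map_target hyt),
      (vectorChart I x).right_inv hyt]
    let L : V →L[ℂ] V := mfderiv I 𝓘(ℂ, V) (vectorChart I x) ((vectorChart I x).symm y)
    let v : V := mfderiv 𝓘(ℂ, V) I (vectorChart I x).symm y u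
    have h2 := toBilinear_compContinuousLinearMap (σ.inChart x y) L v w
    refine (toBilinear_apply (V := V) _ _ _).symm.trans (h2.trans ?_)
    rw [show L v = u from mfderiv_vectorChart_comp_symm hyt u]
    exact hu _
  rw [← mfderiv_vectorChart_comp_symm hyt u, h1]
  exact map_zero _

lemma mdifferentiableAt_coordinateExpression {k : M → M} {x x' : M} {y : V}
    (hy : y ∈ (vectorChart I x).target)
    (hk : MDifferentiableAt I I k ((vectorChart I x).symm y))
    (hky : k ((vectorChart I x).symm y) ∈ (vectorChart I x').source) :
    MDifferentiableAt 𝓘(ℂ, V) 𝓘(ℂ, V)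
      (fun q : V => vectorChart I x' (k ((vectorChart I x).symm q))) y :=
  (mdifferentiableAt_vectorChart hky).comp y (hk.comp y (mdifferentiableAt_vectorChart_symm hy))

/-- The expressions of an invariant two-form in two charts are related by the coordinate
expression of the symmetry. -/
lemma inChart_compContinuousLinearMap_of_pullback_eq {σ : TwoForm I M} {k : M → M} {x x' : M} {y : V}
    (hy : y ∈ (vectorChart I x).target)
    (hk : MDifferentiableAt I I k ((vectorChart I x).symm y))
    (hky : k ((vectorChart I x).symm y) ∈ (vectorChart I x').source)
    (hσ : σ.pullback k ((vectorChart I x).symm y) = σ ((vectorChart I x).symm y)) :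
    let h : V → V := fun q => vectorChart I x' (k ((vectorChart I x).symm q))
    (σ.inChart x' (h y)).compContinuousLinearMap (fderiv ℂ h y) = σ.inChart x y := by
  intro h
  have hks : MDifferentiableAt 𝓘(ℂ, V) I (k ∘ (vectorChart I x).symm) y :=
    hk.comp y (mdifferentiableAt_vectorChart_symm hy)
  have hh : MDifferentiableAt 𝓘(ℂ, V) 𝓘(ℂ, V) h y :=
    mdifferentiableAt_coordinateExpression hy hk hky
  have hev : (vectorChart I x').symm ∘ h =ᶠ[𝓝 y] k ∘ (vectorChart I x).symm := by
    filter_upwards [hks.continuousAt.eventually ((vectorChart I x').open_source.mem_nhds hky)]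
      with q hq
    exact (vectorChart I x').left_inv hq
  have h1 := TwoForm.pullbackTo_comp σ (J := 𝓘(ℂ, V)) (f := (vectorChart I x').symm) (g := h)
    (mdifferentiableAt_vectorChart_symm ((vectorChart I x').map_source hky)) hh
  rw [TwoForm.pullbackTo_congr σ hev, TwoForm.pullbackTo_comp σ hk
    (mdifferentiableAt_vectorChart_symm hy)] at h1
  rw [← mfderiv_eq_fderiv]
  refine Eq.trans h1.symm ?_
  have h2 : σ.pullbackTo I k ((vectorChart I x).symm y) = σ ((vectorChart I x).symm y) := hσ
  rw [h2]
  rfl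

end TwoForms

end HoloDW

namespace HoloDW

open Filter Topology Bundle

/-! ### Charts of a holomorphic vector bundle -/

section BundleCharts

variable {EB : Type*} [NormedAddCommGroup EB] [NormedSpace ℂ EB]
  {B : Type*} [TopologicalSpace B] [ChartedSpace EB B]
  {F : Type*} [NormedAddCommGroup F] [NormedSpace ℂ F]
  {E : B → Type*} [TopologicalSpace (TotalSpace F E)]

/-- The projection of `EB × F` onto the first factor, as an endomorphism. -/
def baseProj (EB F : Type*) [NormedAddCommGroup EB] [NormedSpace ℂ EB]
    [NormedAddCommGroup F] [NormedSpace ℂ F] : EB × F →L[ℂ] EB × F :=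
  (ContinuousLinearMap.fst ℂ EB F).prod 0

lemma fibreScale_baseProj (z : ℂ) (p : EB × F) :
    fibreScale (baseProj EB F) z p = (p.1, z • p.2) := by
  rw [fibreScale_apply, eulerField_apply]
  ext <;> simp [baseProj]

variable [∀ b, AddCommGroup (E b)] [∀ b, Module ℂ (E b)]

/-- Fibrewise scaling of the total space of a vector bundle. -/
def scaleTotal (z : ℂ) (e : TotalSpace F E) : TotalSpace F E := ⟨e.1, z • e.2⟩

lemma scaleTotal_zero_mem (e : TotalSpace F E) : scaleTotal 0 e ∈ zeroSet F E :=
  ⟨e.proj, by simp [scaleTotal, zeroSection]⟩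

lemma scaleTotal_of_mem_zeroSet {e : TotalSpace F E} (he : e ∈ zeroSet F E) (z : ℂ) :
    scaleTotal z e = e := by
  obtain ⟨b, rfl⟩ := he
  exact congrArg (TotalSpace.mk b) (smul_zero z)

variable [∀ b, TopologicalSpace (E b)] [FiberBundle F E]

/-- Points over different base points are separated in `B`, and points of one fibre in a
trivialization. The Hausdorff property enters the uniqueness of integral curves. -/
lemma t2Space_totalSpace [T2Space B] : T2Space (TotalSpace F E) := by
  refine ⟨fun x y hxy => ?_⟩
  by_cases h : x.proj = y.proj
  · let φ := (trivializationAt F E y.proj).toOpenPartialHomeomorph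
    have hy : y ∈ φ.source := (Trivialization.mem_source _).2
      (FiberBundle.mem_baseSet_trivializationAt F E y.proj)
    have hx : x ∈ φ.source := (Trivialization.mem_source _).2
      (h ▸ FiberBundle.mem_baseSet_trivializationAt F E y.proj)
    obtain ⟨u, v, hu, hv, hxu, hyv, huv⟩ := t2_separation (φ.injOn.ne hx hy hxy)
    exact ⟨_, _, φ.isOpen_inter_preimage hu, φ.isOpen_inter_preimage hv, ⟨hx, hxu⟩, ⟨hy, hyv⟩,
      (huv.preimage φ).mono inter_subset_right inter_subset_right⟩
  · obtain ⟨u, v, hu, hv, hxu, hyv, huv⟩ := t2_separation h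
    exact ⟨_, _, hu.preimage (FiberBundle.continuous_proj F E),
      hv.preimage (FiberBundle.continuous_proj F E), hxu, hyv, huv.preimage _⟩

lemma mem_vectorChart_source {x e : TotalSpace F E} :
    e ∈ (vectorChart (𝓘(ℂ, EB).prod 𝓘(ℂ, F)) x).source ↔
      e.proj ∈ (trivializationAt F E x.proj).baseSet ∧ e.proj ∈ (chartAt EB x.proj).source := by
  change e ∈ (extChartAt (𝓘(ℂ, EB).prod 𝓘(ℂ, F)) x).source ↔ _
  rw [FiberBundle.extChartAt]
  simp [Trivialization.mem_source]
  intro h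
  rw [Trivialization.coe_fst' _ h]

lemma vectorChart_apply {x e : TotalSpace F E}
    (he : e.proj ∈ (trivializationAt F E x.proj).baseSet) :
    vectorChart (𝓘(ℂ, EB).prod 𝓘(ℂ, F)) x e =
      (chartAt EB x.proj e.proj, (trivializationAt F E x.proj e).2) := by
  change extChartAt (𝓘(ℂ, EB).prod 𝓘(ℂ, F)) x e = _
  rw [FiberBundle.extChartAt]
  simp [Trivialization.coe_fst' _ he]

lemma scaleTotal_mem_source {x e : TotalSpace F E} (z : ℂ)
    (he : e ∈ (vectorChart (𝓘(ℂ, EB).prod 𝓘(ℂ, F)) x).source) :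
    scaleTotal z e ∈ (vectorChart (𝓘(ℂ, EB).prod 𝓘(ℂ, F)) x).source := by
  rw [mem_vectorChart_source] at he ⊢
  exact he

lemma mem_vectorChart_source_self (x : TotalSpace F E) :
    x ∈ (vectorChart (𝓘(ℂ, EB).prod 𝓘(ℂ, F)) x).source := mem_extChartAt_source x

variable [VectorBundle ℂ F E]

/-- Trivializations are linear on fibres and the base coordinate ignores scaling; hence the scalings
have the same linear form in every bundle chart. -/
lemma vectorChart_scaleTotal {x e : TotalSpace F E} (z : ℂ)
    (he : e ∈ (vectorChart (𝓘(ℂ, EB).prod 𝓘(ℂ, F)) x).source) :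
    vectorChart (𝓘(ℂ, EB).prod 𝓘(ℂ, F)) x (scaleTotal z e) =
      fibreScale (baseProj EB F) z (vectorChart (𝓘(ℂ, EB).prod 𝓘(ℂ, F)) x e) := by
  have h := (mem_vectorChart_source.1 he).1
  rw [vectorChart_apply h, vectorChart_apply (e := scaleTotal z e) h, fibreScale_baseProj]
  refine Prod.ext rfl ?_
  exact ((trivializationAt F E x.proj).linear ℂ h).map_smul z e.2

lemma fibreScale_mem_target {x : TotalSpace F E} (z : ℂ) {y : EB × F}
    (hy : y ∈ (vectorChart (𝓘(ℂ, EB).prod 𝓘(ℂ, F)) x).target) :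
    fibreScale (baseProj EB F) z y ∈ (vectorChart (𝓘(ℂ, EB).prod 𝓘(ℂ, F)) x).target ∧
    (vectorChart (𝓘(ℂ, EB).prod 𝓘(ℂ, F)) x).symm (fibreScale (baseProj EB F) z y) =
      scaleTotal z ((vectorChart (𝓘(ℂ, EB).prod 𝓘(ℂ, F)) x).symm y) := by
  set ψ := vectorChart (𝓘(ℂ, EB).prod 𝓘(ℂ, F)) x
  have h1 := ψ.map_target hy
  have h2 := vectorChart_scaleTotal z h1
  change ψ _ = fibreScale _ z (ψ _) at h2
  rw [ψ.right_inv hy] at h2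
  rw [← h2]
  exact ⟨ψ.map_source (scaleTotal_mem_source z h1), ψ.left_inv (scaleTotal_mem_source z h1)⟩

lemma baseProj_vectorChart {x e : TotalSpace F E} (he : e ∈ zeroSet F E)
    (hes : e ∈ (vectorChart (𝓘(ℂ, EB).prod 𝓘(ℂ, F)) x).source) :
    baseProj EB F (vectorChart (𝓘(ℂ, EB).prod 𝓘(ℂ, F)) x e) =
      vectorChart (𝓘(ℂ, EB).prod 𝓘(ℂ, F)) x e := by
  rw [← fibreScale_zero, ← vectorChart_scaleTotal 0 hes, scaleTotal_of_mem_zeroSet he]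

lemma vectorChart_symm_mem_zeroSet {x : TotalSpace F E} {y : EB × F}
    (hy : y ∈ (vectorChart (𝓘(ℂ, EB).prod 𝓘(ℂ, F)) x).target) (hPy : baseProj EB F y = y) :
    (vectorChart (𝓘(ℂ, EB).prod 𝓘(ℂ, F)) x).symm y ∈ zeroSet F E := by
  have h := (fibreScale_mem_target 0 hy).2
  rw [fibreScale_zero, hPy] at h
  rw [h]
  exact scaleTotal_zero_mem _

end BundleCharts

end HoloDW

namespace HoloDW

open Filter Topology Bundle

/-! ### The Moser atlas of an equivariant vector bundle -/

section CoordinateForms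

variable {V : Type*} [NormedAddCommGroup V] [NormedSpace ℂ V]
  {H : Type*} [TopologicalSpace H] {I : ModelWithCorners ℂ V H}
  {M : Type*} [TopologicalSpace M] [ChartedSpace H M]

/-- The coordinate expression of a two-form as a field of bilinear forms. -/
def coordForm (σ : TwoForm I M) (x : M) (y : V) : V →L[ℂ] V →L[ℂ] ℂ :=
  toBilinear V (σ.inChart x y)

lemma fderiv_sub_apply {D : Type*} [NormedAddCommGroup D] [NormedSpace ℂ D] {S T : V → D} {p : V}
    (hS : DifferentiableAt ℂ S p) (hT : DifferentiableAt ℂ T p) (a : V) :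
    fderiv ℂ (fun q => S q - T q) p a = fderiv ℂ S p a - fderiv ℂ T p a := by
  rw [fderiv_fun_sub hS hT, sub_apply]

lemma IsClosedAt.sub {S T : V → V →L[ℂ] V →L[ℂ] ℂ} {p : V} (hS : IsClosedAt S p)
    (hT : IsClosedAt T p) (hSd : DifferentiableAt ℂ S p) (hTd : DifferentiableAt ℂ T p) :
    IsClosedAt (fun q => S q - T q) p := by
  intro a b c
  have h := fderiv_sub_apply (D := V →L[ℂ] V →L[ℂ] ℂ) hSd hTd
  rw [h, h, h]
  simp only [sub_apply]
  linear_combination hS a b c - hT a b c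

variable [I.Boundaryless] {σ : TwoForm I M} {U : Set M} {x : M} {y : V}

lemma analyticAt_coordForm [CompleteSpace V] (hU : IsOpen U) (hσ : IsComplexSymplecticOn σ U)
    (hy : y ∈ chartDomain I U x) : AnalyticAt ℂ (coordForm σ x) y := by
  have h : AnalyticAt ℂ (toBilinear V) (σ.inChart x y) := by
    apply ContinuousLinearMap.analyticAt
  exact h.comp (analyticAt_inChart hU hσ hy).analyticAt

lemma isClosedAt_coordForm (hU : IsOpen U) (hσ : IsComplexSymplecticOn σ U)
    (hy : y ∈ chartDomain I U x) : IsClosedAt (coordForm σ x) y :=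
  isClosedAt_toBilinear ((analyticAt_inChart hU hσ hy).differentiableAt (by simp))
    (hσ.closed x y hy)

end CoordinateForms

/-! ### Bundle charts translated by the group -/

section Action

variable {G : Type*} [Group G]
  {EB : Type*} [NormedAddCommGroup EB] [NormedSpace ℂ EB]
  {B : Type*} [TopologicalSpace B] [ChartedSpace EB B]
  {F : Type*} [NormedAddCommGroup F] [NormedSpace ℂ F]
  {E : B → Type*} [TopologicalSpace (TotalSpace F E)]
  [∀ b, AddCommGroup (E b)] [∀ b, Module ℂ (E b)] [∀ b, TopologicalSpace (E b)]
  [FiberBundle F E] [MulAction G B] [MulAction G (TotalSpace F E)]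

namespace ActsByBundleAutomorphisms

lemma smul_scaleTotal (hG : ActsByBundleAutomorphisms G (EB := EB) F E) (g : G) (z : ℂ)
    (e : TotalSpace F E) : g • scaleTotal z e = scaleTotal z (g • e) := by
  obtain ⟨L, hL⟩ := hG.linear g e.1
  have h1 : g • e = ⟨g • e.1, L e.2⟩ := hL e.2
  have h2 : g • scaleTotal z e = ⟨g • e.1, L (z • e.2)⟩ := hL (z • e.2)
  rw [h1, h2, L.map_smul]
  rfl

/-- The action of a group element on the total space as a homeomorphism. -/
def homeomorph (hG : ActsByBundleAutomorphisms G (EB := EB) F E) (g : G) :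
    TotalSpace F E ≃ₜ TotalSpace F E where
  toEquiv := MulAction.toPerm g
  continuous_toFun := (hG.holomorphic g).continuous
  continuous_invFun := (hG.holomorphic g⁻¹).continuous

lemma mdifferentiableAt (hG : ActsByBundleAutomorphisms G (EB := EB) F E) (g : G)
    (e : TotalSpace F E) : MDifferentiableAt (𝓘(ℂ, EB).prod 𝓘(ℂ, F)) (𝓘(ℂ, EB).prod 𝓘(ℂ, F))
      (fun q : TotalSpace F E => g • q) e :=
  (hG.holomorphic g).contMDiffAt.mdifferentiableAt (by simp)

/-- The chart at the zero vector over `i.1`, composed with the action of `i.2`. -/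
def chart (hG : ActsByBundleAutomorphisms G (EB := EB) F E) (i : B × G) :
    OpenPartialHomeomorph (TotalSpace F E) (EB × F) :=
  (hG.homeomorph i.2).toOpenPartialHomeomorph ≫ₕ
    vectorChart (𝓘(ℂ, EB).prod 𝓘(ℂ, F)) (zeroSection F E i.1)

variable (hG : ActsByBundleAutomorphisms G (EB := EB) F E)

lemma chart_apply (i : B × G) (e : TotalSpace F E) :
    hG.chart i e = vectorChart (𝓘(ℂ, EB).prod 𝓘(ℂ, F)) (zeroSection F E i.1) (i.2 • e) := rfl

lemma chart_symm_apply (i : B × G) (y : EB × F) :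
    (hG.chart i).symm y =
      i.2⁻¹ • (vectorChart (𝓘(ℂ, EB).prod 𝓘(ℂ, F)) (zeroSection F E i.1)).symm y := rfl

lemma mem_chart_source {i : B × G} {e : TotalSpace F E} :
    e ∈ (hG.chart i).source ↔
      i.2 • e ∈ (vectorChart (𝓘(ℂ, EB).prod 𝓘(ℂ, F)) (zeroSection F E i.1)).source := by
  simp only [chart, OpenPartialHomeomorph.trans_source, Homeomorph.toOpenPartialHomeomorph_source,
    univ_inter]
  rfl

lemma mem_chart_target {i : B × G} {y : EB × F} :
    y ∈ (hG.chart i).target ↔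
      y ∈ (vectorChart (𝓘(ℂ, EB).prod 𝓘(ℂ, F)) (zeroSection F E i.1)).target := by
  simp [chart, homeomorph]

lemma transition_apply (i j : B × G) (y : EB × F) :
    ((hG.chart i).symm ≫ₕ hG.chart j) y =
      vectorChart (𝓘(ℂ, EB).prod 𝓘(ℂ, F)) (zeroSection F E j.1) ((j.2 * i.2⁻¹) •
        (vectorChart (𝓘(ℂ, EB).prod 𝓘(ℂ, F)) (zeroSection F E i.1)).symm y) := by
  rw [mul_smul]
  rfl

lemma mem_transition_source {i j : B × G} {y : EB × F} :
    y ∈ ((hG.chart i).symm ≫ₕ hG.chart j).source ↔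
      y ∈ (vectorChart (𝓘(ℂ, EB).prod 𝓘(ℂ, F)) (zeroSection F E i.1)).target ∧
      (j.2 * i.2⁻¹) • (vectorChart (𝓘(ℂ, EB).prod 𝓘(ℂ, F)) (zeroSection F E i.1)).symm y ∈
        (vectorChart (𝓘(ℂ, EB).prod 𝓘(ℂ, F)) (zeroSection F E j.1)).source := by
  rw [OpenPartialHomeomorph.trans_source, mem_inter_iff, mem_preimage,
    OpenPartialHomeomorph.symm_source, mem_chart_target, mem_chart_source, chart_symm_apply,
    mul_smul]

end ActsByBundleAutomorphisms

variable [IsManifold 𝓘(ℂ, EB) ω B] [VectorBundle ℂ F E] [ContMDiffVectorBundle ω F E 𝓘(ℂ, EB)]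
  {U : Set (TotalSpace F E)}

/-- The transition map from `i` to `j` is the coordinate expression of the group element `j.2 *
i.2⁻¹`, so `G`-invariance of `σ` is compatibility of its coordinate expressions. -/
lemma coordForm_transition (hG : ActsByBundleAutomorphisms G (EB := EB) F E)
    {σ : TwoForm (𝓘(ℂ, EB).prod 𝓘(ℂ, F)) (TotalSpace F E)} (hσ : σ.IsInvariantOn G U)
    {i j : B × G} {y : EB × F} (hy : y ∈ ((hG.chart i).symm ≫ₕ hG.chart j).source)
    (hyU : y ∈ chartDomain (𝓘(ℂ, EB).prod 𝓘(ℂ, F)) U (zeroSection F E i.1)) (u w : EB × F) :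
    coordForm σ (zeroSection F E j.1) (((hG.chart i).symm ≫ₕ hG.chart j) y)
      (fderiv ℂ ((hG.chart i).symm ≫ₕ hG.chart j) y u)
      (fderiv ℂ ((hG.chart i).symm ≫ₕ hG.chart j) y w) =
      coordForm σ (zeroSection F E i.1) y u w := by
  rw [hG.mem_transition_source] at hy
  have h := inChart_compContinuousLinearMap_of_pullback_eq (σ := σ) hy.1
    (hG.mdifferentiableAt (j.2 * i.2⁻¹) _) hy.2 (hσ (j.2 * i.2⁻¹) _ hyU.2)
  have hfun : ((hG.chart i).symm ≫ₕ hG.chart j : EB × F → EB × F) = fun y =>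
      vectorChart (𝓘(ℂ, EB).prod 𝓘(ℂ, F)) (zeroSection F E j.1) ((j.2 * i.2⁻¹) •
        (vectorChart (𝓘(ℂ, EB).prod 𝓘(ℂ, F)) (zeroSection F E i.1)).symm y) :=
    funext (hG.transition_apply i j)
  rw [hfun]
  unfold coordForm
  rw [← h, toBilinear_compContinuousLinearMap]

variable {ω₀ ω₁ : TwoForm (𝓘(ℂ, EB).prod 𝓘(ℂ, F)) (TotalSpace F E)}

/-- Here equivariance becomes chart compatibility: the action is linear on fibres and so commutes
with scaling, and the coordinate forms depend only on the base component of the index. -/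
theorem isMoserAtlas_chart (hG : ActsByBundleAutomorphisms G (EB := EB) F E)
    (hGω₀ : ω₀.IsInvariantOn G U) (hGω₁ : ω₁.IsInvariantOn G U) :
    IsMoserAtlas (baseProj EB F) hG.chart (fun i => coordForm ω₀ (zeroSection F E i.1))
      (fun i y => coordForm ω₁ (zeroSection F E i.1) y - coordForm ω₀ (zeroSection F E i.1) y)
      (fun i => chartDomain (𝓘(ℂ, EB).prod 𝓘(ℂ, F)) U (zeroSection F E i.1)) := by
  constructor
  · exact fun i y hy => hG.mem_chart_target.2 hy.1
  · intro i j y hy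
    rw [hG.mem_transition_source] at hy
    rw [funext (hG.transition_apply i j)]
    exact (mdifferentiableAt_coordinateExpression hy.1
      (hG.mdifferentiableAt (j.2 * i.2⁻¹) _) hy.2).differentiableAt
  · intro i j y hy z
    rw [hG.mem_transition_source] at hy ⊢
    obtain ⟨h1, h2⟩ := fibreScale_mem_target z hy.1
    refine ⟨h1, ?_⟩
    rw [h2, hG.smul_scaleTotal]
    exact scaleTotal_mem_source z hy.2
  · intro i j y hy z
    rw [hG.mem_transition_source] at hy
    obtain ⟨h1, h2⟩ := fibreScale_mem_target z hy.1
    rw [hG.transition_apply, hG.transition_apply, h2, hG.smul_scaleTotal,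
      vectorChart_scaleTotal z hy.2]
  · exact fun i j y hy hyU u w => coordForm_transition hG hGω₀ hy hyU u w
  · intro i j y hy hyU u w
    simp only [sub_apply]
    rw [coordForm_transition hG hGω₀ hy hyU, coordForm_transition hG hGω₁ hy hyU]

variable [FiniteDimensional ℂ EB] [FiniteDimensional ℂ F]

set_option synthInstance.maxHeartbeats 200000 in
lemma isMoserPair_coordForm (hU : IsOpen U) (hω₀ : IsComplexSymplecticOn ω₀ U)
    (hω₁ : IsComplexSymplecticOn ω₁ U) (hZ : ∀ p ∈ zeroSet F E, ω₀ p = ω₁ p)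
    (x : TotalSpace F E) :
    IsMoserPair (baseProj EB F) (coordForm ω₀ x) (fun y => coordForm ω₁ x y - coordForm ω₀ x y)
      (chartDomain (𝓘(ℂ, EB).prod 𝓘(ℂ, F)) U x) := by
  have hcs : CompleteSpace (EB × F) := FiniteDimensional.complete ℂ _
  constructor
  · exact isOpen_chartDomain hU x
  · intro v
    -- The product carries the maximum norm, so discarding the fibre component is a contraction.
    simp [baseProj, Prod.norm_def]
  · intro v
    simp [baseProj]
  · exact fun p hp => analyticAt_coordForm hU hω₀ hp
  · exact fun p hp => (analyticAt_coordForm hU hω₁ hp).sub (analyticAt_coordForm hU hω₀ hp)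
  · exact fun p hp => isClosedAt_coordForm hU hω₀ hp
  · exact fun p hp => (isClosedAt_coordForm hU hω₁ hp).sub (isClosedAt_coordForm hU hω₀ hp)
      (analyticAt_coordForm hU hω₁ hp).differentiableAt
      (analyticAt_coordForm hU hω₀ hp).differentiableAt
  · exact fun p a b => toBilinear_anti _ a b
  · intro p a b
    have h0 : coordForm ω₀ x p a b = - coordForm ω₀ x p b a := toBilinear_anti _ a b
    have h1 : coordForm ω₁ x p a b = - coordForm ω₁ x p b a := toBilinear_anti _ a b
    simp only [sub_apply, h0, h1]
    ring
  · intro p hp hPp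
    have h := hZ _ (vectorChart_symm_mem_zeroSet (x := x) hp.1 hPp)
    have h2 : ω₁.inChart x p = ω₀.inChart x p := by
      change (ω₁ ((vectorChart (𝓘(ℂ, EB).prod 𝓘(ℂ, F)) x).symm p)).compContinuousLinearMap _ =
        (ω₀ ((vectorChart (𝓘(ℂ, EB).prod 𝓘(ℂ, F)) x).symm p)).compContinuousLinearMap _
      rw [h]
    change toBilinear _ (ω₁.inChart x p) - toBilinear _ (ω₀.inChart x p) = 0
    rw [h2]
    exact sub_self (G := EB × F →L[ℂ] EB × F →L[ℂ] ℂ) _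

/-- The forms have a Moser flow near each point of the zero section. -/
theorem nonempty_localMoserFlow_coordForm (hU : IsOpen U) (hω₀ : IsComplexSymplecticOn ω₀ U)
    (hω₁ : IsComplexSymplecticOn ω₁ U) (hZ : ∀ p ∈ zeroSet F E, ω₀ p = ω₁ p)
    {x : TotalSpace F E} (hx : x ∈ zeroSet F E) (hxU : x ∈ U) :
    Nonempty (LocalMoserFlow (baseProj EB F) (coordForm ω₀ x)
      (fun y => coordForm ω₁ x y - coordForm ω₀ x y)
      (chartDomain (𝓘(ℂ, EB).prod 𝓘(ℂ, F)) U x)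
      (vectorChart (𝓘(ℂ, EB).prod 𝓘(ℂ, F)) x x)) := by
  have hcs : CompleteSpace (EB × F) := FiniteDimensional.complete ℂ _
  have hxs := mem_vectorChart_source_self (EB := EB) x
  have hxd : vectorChart (𝓘(ℂ, EB).prod 𝓘(ℂ, F)) x x ∈
      chartDomain (𝓘(ℂ, EB).prod 𝓘(ℂ, F)) U x := by
    refine ⟨(vectorChart (𝓘(ℂ, EB).prod 𝓘(ℂ, F)) x).map_source hxs, ?_⟩
    change (vectorChart (𝓘(ℂ, EB).prod 𝓘(ℂ, F)) x).symm _ ∈ U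
    rwa [(vectorChart (𝓘(ℂ, EB).prod 𝓘(ℂ, F)) x).left_inv hxs]
  obtain ⟨e, he⟩ := exists_equiv_dual
    (L := coordForm ω₀ x (vectorChart (𝓘(ℂ, EB).prod 𝓘(ℂ, F)) x x))
    fun u hu => inChart_nondegenerate hω₀ hxd hu
  exact nonempty_localMoserFlow (isMoserPair_coordForm hU hω₀ hω₁ hZ x) hxd
    (baseProj_vectorChart hx hxs) e he

end Action

end HoloDW

namespace HoloDW

open Filter Topology Bundle

section Main

lemma eq_of_toBilinear_eq {V : Type*} [NormedAddCommGroup V] [NormedSpace ℂ V]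
    {φ ψ : V [⋀^Fin 2]→L[ℂ] ℂ} (h : ∀ u w, toBilinear V φ u w = toBilinear V ψ u w) : φ = ψ := by
  ext v
  have hv : v = ![v 0, v 1] := by
    ext i
    fin_cases i <;> rfl
  rw [hv, ← toBilinear_apply, ← toBilinear_apply, h]

variable {G : Type*} [Group G]
  {EB : Type*} [NormedAddCommGroup EB] [NormedSpace ℂ EB]
  {B : Type*} [TopologicalSpace B] [ChartedSpace EB B]
  {F : Type*} [NormedAddCommGroup F] [NormedSpace ℂ F]
  {E : B → Type*} [TopologicalSpace (TotalSpace F E)]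
  [∀ b, AddCommGroup (E b)] [∀ b, Module ℂ (E b)] [∀ b, TopologicalSpace (E b)]
  [FiberBundle F E] [MulAction G B] [MulAction G (TotalSpace F E)]
  [IsManifold 𝓘(ℂ, EB) ω B] [VectorBundle ℂ F E] [ContMDiffVectorBundle ω F E 𝓘(ℂ, EB)]

namespace ActsByBundleAutomorphisms

variable (hG : ActsByBundleAutomorphisms G (EB := EB) F E) {i : B × G}

lemma contMDiffAt_chart {p : TotalSpace F E} (hp : p ∈ (hG.chart i).source) :
    ContMDiffAt (𝓘(ℂ, EB).prod 𝓘(ℂ, F)) 𝓘(ℂ, EB × F) ω (hG.chart i) p :=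
  (contMDiffAt_vectorChart (hG.mem_chart_source.1 hp)).comp p (hG.holomorphic i.2).contMDiffAt

lemma contMDiffAt_chart_symm {y : EB × F} (hy : y ∈ (hG.chart i).target) :
    ContMDiffAt 𝓘(ℂ, EB × F) (𝓘(ℂ, EB).prod 𝓘(ℂ, F)) ω (hG.chart i).symm y :=
  (hG.holomorphic i.2⁻¹).contMDiffAt.comp y
    (contMDiffAt_vectorChart_symm (hG.mem_chart_target.1 hy))

lemma contMDiffAt_chart_conj {p : TotalSpace F E} (hp : p ∈ (hG.chart i).source)
    {φ : EB × F → EB × F} (hφ : ContDiffAt ℂ ω φ (hG.chart i p))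
    (ht : φ (hG.chart i p) ∈ (hG.chart i).target) :
    ContMDiffAt (𝓘(ℂ, EB).prod 𝓘(ℂ, F)) (𝓘(ℂ, EB).prod 𝓘(ℂ, F)) ω
      (fun q => (hG.chart i).symm (φ (hG.chart i q))) p :=
  ContMDiffAt.comp p (g := (hG.chart i).symm) (f := φ ∘ hG.chart i) (hG.contMDiffAt_chart_symm ht)
    (hφ.contMDiffAt.comp p (hG.contMDiffAt_chart hp))

variable {U : Set (TotalSpace F E)}
  {σ τ : TwoForm (𝓘(ℂ, EB).prod 𝓘(ℂ, F)) (TotalSpace F E)}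

/-- The inverse chart ends with the action of `i.2⁻¹`, which preserves `σ`; so the group component
of the index drops out. -/
lemma pullbackTo_chart_symm (hσ : σ.IsInvariantOn G U) {y : EB × F}
    (hy : y ∈ chartDomain (𝓘(ℂ, EB).prod 𝓘(ℂ, F)) U (zeroSection F E i.1)) :
    σ.pullbackTo 𝓘(ℂ, EB × F) (hG.chart i).symm y = σ.inChart (zeroSection F E i.1) y := by
  have h := TwoForm.pullbackTo_comp σ (J' := 𝓘(ℂ, EB × F)) (y := y)
    (f := fun q : TotalSpace F E => i.2⁻¹ • q)
    (g := (vectorChart (𝓘(ℂ, EB).prod 𝓘(ℂ, F)) (zeroSection F E i.1)).symm)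
    (hG.mdifferentiableAt i.2⁻¹ _) (mdifferentiableAt_vectorChart_symm hy.1)
  refine Eq.trans h ?_
  have h2 : σ.pullbackTo (𝓘(ℂ, EB).prod 𝓘(ℂ, F)) (fun q : TotalSpace F E => i.2⁻¹ • q)
      ((vectorChart (𝓘(ℂ, EB).prod 𝓘(ℂ, F)) (zeroSection F E i.1)).symm y) =
      σ ((vectorChart (𝓘(ℂ, EB).prod 𝓘(ℂ, F)) (zeroSection F E i.1)).symm y) :=
    hσ i.2⁻¹ _ hy.2
  rw [h2]
  rfl

/-- A map that matches the coordinate expressions of two invariant forms matches the forms. -/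
lemma pullback_chart_conj (hσ : σ.IsInvariantOn G U) (hτ : τ.IsInvariantOn G U)
    {p : TotalSpace F E} (hp : p ∈ (hG.chart i).source)
    (hpU : hG.chart i p ∈ chartDomain (𝓘(ℂ, EB).prod 𝓘(ℂ, F)) U (zeroSection F E i.1))
    {φ : EB × F → EB × F} (hφ : DifferentiableAt ℂ φ (hG.chart i p))
    (hφU : φ (hG.chart i p) ∈ chartDomain (𝓘(ℂ, EB).prod 𝓘(ℂ, F)) U (zeroSection F E i.1))
    (h : ∀ u w, coordForm τ (zeroSection F E i.1) (φ (hG.chart i p))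
      (fderiv ℂ φ (hG.chart i p) u) (fderiv ℂ φ (hG.chart i p) w) =
      coordForm σ (zeroSection F E i.1) (hG.chart i p) u w) :
    τ.pullback (fun q => (hG.chart i).symm (φ (hG.chart i q))) p = σ p := by
  have hφm : MDifferentiableAt 𝓘(ℂ, EB × F) 𝓘(ℂ, EB × F) φ (hG.chart i p) :=
    hφ.mdifferentiableAt
  have hc := (hG.contMDiffAt_chart hp).mdifferentiableAt (by simp)
  have hs : ∀ {y}, y ∈ chartDomain (𝓘(ℂ, EB).prod 𝓘(ℂ, F)) U (zeroSection F E i.1) →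
      MDifferentiableAt 𝓘(ℂ, EB × F) (𝓘(ℂ, EB).prod 𝓘(ℂ, F)) (hG.chart i).symm y := fun hy =>
    (hG.contMDiffAt_chart_symm (hG.mem_chart_target.2 hy.1)).mdifferentiableAt (by simp)
  have h1 := TwoForm.pullbackTo_comp τ (f := (hG.chart i).symm) (g := φ) (hs hφU) hφm
  have h2 := TwoForm.pullbackTo_comp τ (f := (hG.chart i).symm ∘ φ) (g := hG.chart i)
    ((hs hφU).comp _ hφm) hc
  have h3 := TwoForm.pullbackTo_comp σ (f := (hG.chart i).symm) (g := hG.chart i) (hs hpU) hc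
  rw [hG.pullbackTo_chart_symm hτ hφU] at h1
  rw [hG.pullbackTo_chart_symm hσ hpU] at h3
  have h4 : τ.pullbackTo 𝓘(ℂ, EB × F) ((hG.chart i).symm ∘ φ) (hG.chart i p) =
      σ.inChart (zeroSection F E i.1) (hG.chart i p) := by
    rw [h1, mfderiv_eq_fderiv]
    refine eq_of_toBilinear_eq (V := EB × F) fun u w => ?_
    exact (toBilinear_compContinuousLinearMap (V := EB × F) (V' := EB × F) _ _ u w).trans (h u w)
  rw [h4, ← h3] at h2
  refine Eq.trans h2 ((TwoForm.pullbackTo_congr σ ?_).trans (TwoForm.pullbackTo_id σ p))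
  filter_upwards [(hG.chart i).open_source.mem_nhds hp] with q hq
  exact (hG.chart i).left_inv hq

end ActsByBundleAutomorphisms

end Main

end HoloDW

end

/-! ### The equivariant Darboux–Weinstein theorem -/

open HoloDW Filter Topology

theorem mainTheorem4
    {G : Type*} [Group G]
    -- the base, a complex manifold
    {EB : Type*} [NormedAddCommGroup EB] [NormedSpace ℂ EB] [FiniteDimensional ℂ EB]
    {B : Type*} [TopologicalSpace B] [T2Space B] [ChartedSpace EB B]
    [IsManifold 𝓘(ℂ, EB) ω B]
    -- the holomorphic vector bundle
    {F : Type*} [NormedAddCommGroup F] [NormedSpace ℂ F] [FiniteDimensional ℂ F]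
    {E : B → Type*} [TopologicalSpace (Bundle.TotalSpace F E)]
    [∀ b, AddCommGroup (E b)] [∀ b, Module ℂ (E b)] [∀ b, TopologicalSpace (E b)]
    [FiberBundle F E] [VectorBundle ℂ F E] [ContMDiffVectorBundle ω F E 𝓘(ℂ, EB)]
    -- the action
    [MulAction G B] [MulAction G (Bundle.TotalSpace F E)]
    (hG : HoloDW.ActsByBundleAutomorphisms G (EB := EB) F E)
    -- the two forms
    (U : Set (Bundle.TotalSpace F E)) (hU : IsOpen U) (hZU : HoloDW.zeroSet F E ⊆ U)
    (hGU : HoloDW.IsInvariant G U)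
    (ω₀ ω₁ : HoloDW.TwoForm (𝓘(ℂ, EB).prod 𝓘(ℂ, F)) (Bundle.TotalSpace F E))
    (hω₀ : HoloDW.IsComplexSymplecticOn ω₀ U) (hω₁ : HoloDW.IsComplexSymplecticOn ω₁ U)
    (hGω₀ : HoloDW.TwoForm.IsInvariantOn G ω₀ U) (hGω₁ : HoloDW.TwoForm.IsInvariantOn G ω₁ U)
    (hZ : ∀ p ∈ HoloDW.zeroSet F E, ω₀ p = ω₁ p) :
    -- `f` is a homeomorphism from the open set `f.source` onto the open set `f.target`
    ∃ f : OpenPartialHomeomorph (Bundle.TotalSpace F E) (Bundle.TotalSpace F E),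
      (HoloDW.zeroSet F E ⊆ f.source ∧ f.source ⊆ U ∧ HoloDW.IsInvariant G f.source) ∧
      (HoloDW.zeroSet F E ⊆ f.target ∧ f.target ⊆ U ∧ HoloDW.IsInvariant G f.target) ∧
      ContMDiffOn (𝓘(ℂ, EB).prod 𝓘(ℂ, F)) (𝓘(ℂ, EB).prod 𝓘(ℂ, F)) ω f f.source ∧
      ContMDiffOn (𝓘(ℂ, EB).prod 𝓘(ℂ, F)) (𝓘(ℂ, EB).prod 𝓘(ℂ, F)) ω f.symm f.target ∧
      (∀ g : G, ∀ p ∈ f.source, f (g • p) = g • f p) ∧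
      (∀ p ∈ f.source, ω₁.pullback f p = ω₀ p) ∧
      (∀ p ∈ HoloDW.zeroSet F E, f p = p) := by
  have hT2 : T2Space (Bundle.TotalSpace F E) := t2Space_totalSpace
  have hzs : ∀ b, Bundle.zeroSection F E b ∈ zeroSet F E := fun b => ⟨b, rfl⟩
  let D' := fun b : B => (nonempty_localMoserFlow_coordForm hU hω₀ hω₁ hZ (hzs b)
    (hZU (hzs b))).some
  -- The local flow is chosen once per base point and shared by all group translates of the chart;
  -- equivariance of `f` rests on this.
  let D := fun i : B × G => D' i.1
  obtain ⟨f, hfs, hf⟩ := (isMoserAtlas_chart hG hGω₀ hGω₁).exists_timeOneMap D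
    fun i p hp u hu => inChart_nondegenerate hω₀ hp hu
  have hsU : f.source ⊆ U := by
    intro p hp
    obtain ⟨i, hi, hiD⟩ := (hfs p).1 hp
    have h : (hG.chart i).symm (hG.chart i p) ∈ U :=
      hGU _ _ ((D i).region_subset ((D i).domain_subset hiD)).2
    rwa [(hG.chart i).left_inv hi] at h
  have hZs : zeroSet F E ⊆ f.source := by
    rintro _ ⟨b, rfl⟩
    refine (hfs _).2 ⟨(b, 1), ?_, ?_⟩
    · rw [hG.mem_chart_source, one_smul]
      exact mem_vectorChart_source_self _
    · rw [hG.chart_apply, one_smul]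
      exact (D (b, 1)).mem_domain
  have hequiv : ∀ g : G, ∀ p ∈ f.source, g • p ∈ f.source ∧ f (g • p) = g • f p := by
    intro g p hp
    obtain ⟨⟨b, k⟩, hi, hiD⟩ := (hfs p).1 hp
    -- The point `g • p` has in the chart `(b, k * g⁻¹)` the coordinates of `p` in `(b, k)`. Both
    -- charts use the same flow, and their inverses differ by the action of `g`.
    have hkp : (k * g⁻¹) • g • p = k • p := by rw [smul_smul, inv_mul_cancel_right]
    have hi' : g • p ∈ (hG.chart (b, k * g⁻¹)).source := by
      rw [hG.mem_chart_source] at hi ⊢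
      rwa [hkp]
    have hc : hG.chart (b, k * g⁻¹) (g • p) = hG.chart (b, k) p := by
      rw [hG.chart_apply, hG.chart_apply, hkp]
    have hiD' : hG.chart (b, k * g⁻¹) (g • p) ∈ (D (b, k * g⁻¹)).domain := by
      rw [hc]
      exact hiD
    refine ⟨(hfs _).2 ⟨_, hi', hiD'⟩, ?_⟩
    rw [(hf _ _ hi' hiD').2.1, (hf _ _ hi hiD).2.1, hc, hG.chart_symm_apply, hG.chart_symm_apply,
      mul_inv_rev, inv_inv, mul_smul]
  have hfix : ∀ p ∈ zeroSet F E, f p = p := by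
    intro p hp
    obtain ⟨i, hi, hiD⟩ := (hfs p).1 (hZs hp)
    have hmem : i.2 • p ∈ zeroSet F E := by
      rw [← scaleTotal_of_mem_zeroSet hp 0, hG.smul_scaleTotal]
      exact scaleTotal_zero_mem _
    rw [(hf i p hi hiD).2.1, (D i).isMoserFlow.fix _ hiD
      (baseProj_vectorChart hmem (hG.mem_chart_source.1 hi)), (hG.chart i).left_inv hi]
  have hflow : ∀ i, ∀ p ∈ (hG.chart i).source, hG.chart i p ∈ (D i).domain →
      (D i).flow (hG.chart i p) 1 ∈
        chartDomain (𝓘(ℂ, EB).prod 𝓘(ℂ, F)) U (Bundle.zeroSection F E i.1) := fun i p _ hiD =>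
    (D i).region_subset ((D i).isMoserFlow.mem _ hiD 1 (by norm_num))
  have hev : ∀ i, ∀ p ∈ (hG.chart i).source, hG.chart i p ∈ (D i).domain →
      ∀ᶠ q in 𝓝 p, f q = (hG.chart i).symm ((D i).flow (hG.chart i q) 1) := by
    intro i p hi hiD
    filter_upwards [(hG.chart i).open_source.mem_nhds hi, ((hG.chart i).continuousAt hi).eventually
      ((D i).isOpen_domain.mem_nhds hiD)] with q hq hqD
    exact (hf i q hq hqD).2.1
  refine ⟨f, ⟨hZs, hsU, fun g p hp => (hequiv g p hp).1⟩, ⟨?_, ?_, ?_⟩, ?_, ?_,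
    fun g p hp => (hequiv g p hp).2, ?_, hfix⟩
  · intro p hp
    rw [← hfix p hp]
    exact f.map_source (hZs hp)
  · intro p hp
    obtain ⟨i, hi, hiD⟩ := (hfs _).1 (f.map_target hp)
    rw [← f.right_inv hp, (hf i _ hi hiD).2.1]
    exact hGU _ _ (hflow i _ hi hiD).2
  · intro g p hp
    rw [← f.right_inv hp, ← (hequiv g _ (f.map_target hp)).2]
    exact f.map_source (hequiv g _ (f.map_target hp)).1
  · intro p hp
    obtain ⟨i, hi, hiD⟩ := (hfs p).1 hp
    have hcs : CompleteSpace (EB × F) := FiniteDimensional.complete ℂ _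
    exact ((hG.contMDiffAt_chart_conj hi (φ := fun y => (D i).flow y 1)
      ((D i).isMoserFlow.analytic _ hiD).contDiffAt (hf i p hi hiD).1).congr_of_eventuallyEq
      (hev i p hi hiD)).contMDiffWithinAt
  · intro p' hp'
    obtain ⟨p, hp, rfl⟩ : ∃ p ∈ f.source, f p = p' := ⟨_, f.map_target hp', f.right_inv hp'⟩
    obtain ⟨i, hi, hiD⟩ := (hfs p).1 hp
    obtain ⟨ht, hfp, g, hg, hgp, hgev⟩ := hf i p hi hiD
    have hfi : f p ∈ (hG.chart i).source := by
      rw [hfp]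
      exact (hG.chart i).map_target ht
    refine ((hG.contMDiffAt_chart_conj hfi hg ?_).congr_of_eventuallyEq hgev).contMDiffWithinAt
    rw [hgp]
    exact (hG.chart i).map_source hi
  · intro p hp
    obtain ⟨i, hi, hiD⟩ := (hfs p).1 hp
    have h := hG.pullback_chart_conj (φ := fun y => (D i).flow y 1) hGω₀ hGω₁ hi
      ((D i).region_subset ((D i).domain_subset hiD))
      ((D i).isMoserFlow.analytic _ hiD).differentiableAt (hflow i p hi hiD) fun u w => by
        rw [← (D i).isMoserFlow.pullback _ hiD u w]
        simp only [add_apply, sub_apply]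
        ring
    exact (TwoForm.pullbackTo_congr ω₁ (hev i p hi hiD)).trans h
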